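/- **Setting.** Let $F_X$ be the CDF of a probability measure on $\mathbb R$, twice continuously differentiable on $\{F_X>0\}$, with density $f_X=F_X'$. Let $K$ be a CDF kernel: nondecreasing, $K(-\infty)=0$, $K(\infty)=1$, absolutely continuous, with $\int u^2K'(u)\,du<\infty$. Put $\mu_{K,p}=\int u^pK'(u)\,du$ and $\mu_{K^2,p}=\int u^p(K^2)'(u)\,du$. For blocks of size $n$ with $h$ the common bandwidth in a block, the inner estimator is $F_h(y)=\frac1n\sum_{j\le n}K\big(\frac{y-X_j}{h}\big)$. The second-order expansion in $h$ of $\mathbb E[F_h(y)^N]$, with the central moments of $F_h(y)$ replaced by those of a normal law of the same variance, has the following coefficients. With $$\alpha=f_X\mu_{K^2,1}-2F_Xf_X\mu_{K,1},\qquad \beta=\tfrac12 f_X'\mu_{K^2,2}-f_X'F_X\mu_{K,2}-f_X^2\mu_{K,1}^2,\qquad w_{N,k}=\binom N{2k}\frac{(2k-1)!!}{n^k},$$ $$FY_{0,N}=\sum_{k=0}^{\lfloor N/2\rfloor}w_{N,k}F_X^{N-k}(1-F_X)^k,\qquad FY_{1,N}=-\alpha\sum_{k=1}^{\lfloor N/2\rfloor}k\,w_{N,k}F_X^{N-k-1}(1-F_X)^{k-1},$$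 $$FY_{2,\alpha,N}=\alpha^2\sum_{k=2}^{\lfloor N/2\rfloor}\tfrac{k(k-1)}2w_{N,k}F_X^{N-k-2}(1-F_X)^{k-2},\qquad FY_{2,\beta,N}=\beta\sum_{k=1}^{\lfloor N/2\rfloor}k\,w_{N,k}F_X^{N-k-1}(1-F_X)^{k-1},$$ let $E_{0,N}=FY_{0,N}$, $E_{1,N}=FY_{1,N}-Nf_X\mu_{K,1}FY_{0,N-1}$, and $$E_{2,N}=FY_{2,\beta,N}+\tfrac N2f_X'\mu_{K,2}FY_{0,N-1}+FY_{2,\alpha,N}-Nf_X\mu_{K,1}FY_{1,N-1}+\tbinom N2f_X^2\mu_{K,1}^2FY_{0,N-2}.$$ The bias and variance coefficients of a block of size $n$ are $$b_0=E_{0,n}-F_X^n,\quad b_1=E_{1,n},\quad b_2=E_{2,n},\quad V_2=E_{2,2n}-2E_{0,n}E_{2,n}-E_{1,n}^2 .$$ For $m$ blocks of equal size $n$ and $q\in(0,1)$, the Hessian of the second-order expansion of the MISE over the $q$-tail $T_q=\{y:F_X(y)\ge q\}$, as a function of the block bandwidths $h_1,\dots,h_m$, is the $m\times m$ matrix $$\mathbf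 Q_{kl}=\int_{T_q}\Big(b_1^2+\delta_{kl}\big(2m\,b_0b_2+V_2\big)\Big)\,dy .$$ The MISE minimum is called stable when $\mathbf Q$ is positive definite. **Theorem.** Assume $\mu_{K,1}=0$. Let $F_X$ have extreme value index $\gamma>-\frac12$ (i.e. lie in the max-domain of attraction of $G_\gamma$), with power-type tail: for some $D\in(0,\infty)$, $f_X(y)/(1-F_X(y))^{\gamma+1}\to D$ as $y$ increases to the right endpoint of $F_X$. Assume that $f_X'$ is integrable on $T_q$. Set $$C_b=D\,\Gamma(\gamma+2)\Big[\tfrac{\mu_{K^2,2}}4\big(1-(\tfrac23)^{\gamma+1}\big)-\tfrac{\mu_{K^2,1}^2}8\big(1-(\tfrac23)^{\gamma+2}\big)\Big],\qquad C_V=D\,\mu_{K^2,1}^2\,\Gamma\big(\tfrac\gamma2+1\big)\,3^{-1-\gamma/2}.$$ Then: 1. For every $n>1$ the functions $b_1^2$, $b_0b_2$ and $V_2$ are integrable on $T_q$. 2. As $n\to\infty$, $\ n^{\gamma}\int_{T_q}b_0b_2\,dy\to-C_b\ $ and $\ n^{-(1-\gamma/2)}\int_{T_q}V_2\,dy\to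 C_V$, where $C_V>0$. 3. There is a constant $C>0$ such that, for all sufficiently large $n$ and all $m\ge1$ with $m<C\,n^{1+\gamma/2}$, the matrix $\mathbf Q$ is positive definite. 4. If $C_b>0$, then $C(\gamma,F_X,K)=C_V/(2C_b)$ is the sharp constant: for every $C<C(\gamma,F_X,K)$ and all sufficiently large $n$, $\mathbf Q$ is positive definite for all $m\ge1$ with $m<C\,n^{1+\gamma/2}$; for every $C>C(\gamma,F_X,K)$ and all sufficiently large $n$, $\mathbf Q$ is not positive definite for any $m\ge C\,n^{1+\gamma/2}$. 5. If $K$ is symmetric, i.e. $K(-u)=1-K(u)$ for all $u$ (for instance Gaussian), then $C_b>0$. -/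

import Mathlib

open MeasureTheory ProbabilityTheory Filter Topology

namespace DDEVD

noncomputable section

/-- A CDF kernel: nondecreasing, with limits `0` and `1`, absolutely continuous (so that its
density is `K'`), with finite second moment. Since `0 ≤ K ≤ 1`, the first two moments of the
distributions with distribution functions `K` and `K ^ 2` are then all finite. -/
structure IsCDFKernel (K : ℝ → ℝ) : Prop where
  mono : Monotone K
  tendsto_atBot : Tendsto K atBot (𝓝 0)
  tendsto_atTop : Tendsto K atTop (𝓝 1)
  absCont : ∀ a b : ℝ, AbsolutelyContinuousOnInterval K a b
  moment : Integrable (fun u : ℝ => u ^ 2 * deriv K u)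

/-- The kernel moment `μ_{K,p} = ∫ u ^ p K'(u) du`. -/
def mu (K : ℝ → ℝ) (p : ℕ) : ℝ := ∫ u : ℝ, u ^ p * deriv K u

/-- The moment `μ_{K²,p} = ∫ u ^ p (K²)'(u) du` of the squared kernel. -/
def muSq (K : ℝ → ℝ) (p : ℕ) : ℝ := mu (fun u => K u ^ 2) p

/-! ### Extreme value index -/

/-- The standard extreme value distribution function `G_γ` at a point `x` with `1 + γ x > 0`. -/
def gevCDF (γ x : ℝ) : ℝ :=
  if γ = 0 then Real.exp (-Real.exp (-x)) else Real.exp (-(1 + γ * x) ^ (-1 / γ))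

/-- `F` lies in the max-domain of attraction of `G_γ`. -/
def HasExtremeValueIndex (F : ℝ → ℝ) (γ : ℝ) : Prop :=
  ∃ a b : ℕ → ℝ, (∀ n, 0 < a n) ∧ ∀ x : ℝ, 0 < 1 + γ * x →
    Tendsto (fun n : ℕ => F (a n * x + b n) ^ n) atTop (𝓝 (gevCDF γ x))

/-- The tail condition `f(y) ∼ D (1 - F(y)) ^ (γ + 1)` for the density `f = F'`, as `y` increases
to the right endpoint of `F`, i.e. as `F y → 1` with `F y < 1`. -/
def HasTailDensity (F : ℝ → ℝ) (γ D : ℝ) : Prop :=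
  Tendsto (fun y => deriv F y / (1 - F y) ^ (γ + 1)) (comap F (𝓝[<] 1)) (𝓝 D)

/-- The `q`-tail `{y | F y ≥ q} = [F⁻¹(q), ∞)`. -/
def qTail (F : ℝ → ℝ) (q : ℝ) : Set ℝ := {y | q ≤ F y}

/-! ### Coefficients of the second order expansion

`F` is the base distribution function, `deriv F` its density, `K` the kernel, `n` the size of the
block. The moments `E[F_h(y) ^ N]` are needed for `N = n` and `N = 2 n`. -/

def alpha (F K : ℝ → ℝ) (y : ℝ) : ℝ :=
  deriv F y * muSq K 1 - 2 * F y * deriv F y * mu K 1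

def beta (F K : ℝ → ℝ) (y : ℝ) : ℝ :=
  deriv (deriv F) y * muSq K 2 / 2 - deriv (deriv F) y * F y * mu K 2
    - deriv F y ^ 2 * mu K 1 ^ 2

/-- `binom(N, 2k) (2k - 1)!! / n ^ k`; for `k = 0` this is `1`. -/
def gaussWeight (n N k : ℕ) : ℝ :=
  (N.choose (2 * k) : ℝ) * (Nat.doubleFactorial (2 * k - 1) : ℝ) / (n : ℝ) ^ k

def FY0 (F : ℝ → ℝ) (n N : ℕ) (y : ℝ) : ℝ :=
  ∑ k ∈ Finset.Icc 0 (N / 2), gaussWeight n N k * F y ^ (N - k) * (1 - F y) ^ k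

def FY1 (F K : ℝ → ℝ) (n N : ℕ) (y : ℝ) : ℝ :=
  -∑ k ∈ Finset.Icc 1 (N / 2),
    (k : ℝ) * gaussWeight n N k * F y ^ (N - k - 1) * (1 - F y) ^ (k - 1) * alpha F K y

def FY2alpha (F K : ℝ → ℝ) (n N : ℕ) (y : ℝ) : ℝ :=
  ∑ k ∈ Finset.Icc 2 (N / 2),
    ((k : ℝ) * ((k : ℝ) - 1) / 2) * gaussWeight n N k
      * F y ^ (N - k - 2) * (1 - F y) ^ (k - 2) * alpha F K y ^ 2

def FY2beta (F K : ℝ → ℝ) (n N : ℕ) (y : ℝ) : ℝ :=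
  ∑ k ∈ Finset.Icc 1 (N / 2),
    (k : ℝ) * gaussWeight n N k * F y ^ (N - k - 1) * (1 - F y) ^ (k - 1) * beta F K y

/-! Coefficients of `1`, `h`, `h²`, `h²` in the expansion of `E[F_h(y) ^ N]`. -/

def E0 (F : ℝ → ℝ) (n N : ℕ) (y : ℝ) : ℝ := FY0 F n N y

def E1 (F K : ℝ → ℝ) (n N : ℕ) (y : ℝ) : ℝ :=
  FY1 F K n N y - N * deriv F y * mu K 1 * FY0 F n (N - 1) y

def E2a (F K : ℝ → ℝ) (n N : ℕ) (y : ℝ) : ℝ :=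
  FY2beta F K n N y + (N : ℝ) / 2 * deriv (deriv F) y * mu K 2 * FY0 F n (N - 1) y

def E2b (F K : ℝ → ℝ) (n N : ℕ) (y : ℝ) : ℝ :=
  FY2alpha F K n N y - N * deriv F y * mu K 1 * FY1 F K n (N - 1) y
    + (N.choose 2 : ℝ) * deriv F y ^ 2 * mu K 1 ^ 2 * FY0 F n (N - 2) y

/-! Bias coefficients of a block of size `n`. -/

def b0 (F : ℝ → ℝ) (n : ℕ) (y : ℝ) : ℝ := E0 F n n y - F y ^ n

def b1 (F K : ℝ → ℝ) (n : ℕ) (y : ℝ) : ℝ := E1 F K n n y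

def b2 (F K : ℝ → ℝ) (n : ℕ) (y : ℝ) : ℝ := E2a F K n n y + E2b F K n n y

/-! Second order variance coefficients of a block of size `n`. -/

def V2a (F K : ℝ → ℝ) (n : ℕ) (y : ℝ) : ℝ :=
  E2a F K n (2 * n) y - 2 * E0 F n n y * E2a F K n n y

def V2b (F K : ℝ → ℝ) (n : ℕ) (y : ℝ) : ℝ :=
  E2b F K n (2 * n) y - 2 * E0 F n n y * E2b F K n n y - E1 F K n n y ^ 2

def V2 (F K : ℝ → ℝ) (n : ℕ) (y : ℝ) : ℝ := V2a F K n y + V2b F K n y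

/-- The Hessian matrix `Q` of the quadratic terms in the block bandwidths `h_1, …, h_m` of the
second order expansion of the `q`-MISE, for blocks of sizes `ns 1, …, ns m`. -/
def hessian (F K : ℝ → ℝ) (q : ℝ) {m : ℕ} (ns : Fin m → ℕ) : Matrix (Fin m) (Fin m) ℝ :=
  Matrix.of fun k l => ∫ y in qTail F q,
    (b1 F K (ns k) y * b1 F K (ns l) y
      + (if k = l then 2 * (∑ j, b0 F (ns j) y) * b2 F K (ns k) y + V2 F K (ns k) y else 0))

/-! ### Leading constants -/

def constB (γ D : ℝ) (K : ℝ → ℝ) : ℝ :=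
  D * Real.Gamma (γ + 2) *
    (muSq K 2 / 4 * (1 - (2 / 3 : ℝ) ^ (γ + 1)) - muSq K 1 ^ 2 / 8 * (1 - (2 / 3 : ℝ) ^ (γ + 2)))

def constV (γ D : ℝ) (K : ℝ → ℝ) : ℝ :=
  D * muSq K 1 ^ 2 * Real.Gamma (γ / 2 + 1) * (3 : ℝ) ^ (-1 - γ / 2)

end

end DDEVD

/-!
The polynomial `FY0` is the `N`-th moment of a normal law with mean `u = F y` and variance
`u (1 - u) / n` (`gaussMoment_eq_integral`), and for a centred kernel the sums in `FY1`, `FY2alpha`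
and `FY2beta` are again such moments, of order `N - 2` or `N - 4`. Hence `b_0 b_2` and `V_2` both
have the form `F'' φ(F) + F' ^ 2 ψ(F)` with explicit `φ` and `ψ` (`b0_mul_b2_eq`, `V2_eq`).
Integration by parts removes `F''` and leaves the integral of `F' ^ 2 (ψ - φ')(F)`, up to a boundary
term at the level `q`, which is exponentially small. In the variable `u = F y` this is the integral
of `G (ψ - φ')` over `(q, 1)`, where the density `G` at level `u` is about `D (1 - u) ^ (γ + 1)`
(`RegularTail.exists_density_quantile`), so that the limits follow by dominated convergence
(`RegularTail.tendsto_integral_sq_mul`).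

* The bias integral lives at `1 - u = x / n`, where the moments of order about `n` tend to
  `exp (-x / 2)` (`tendsto_gaussMoment_inner`).
* The variance integral lives at `1 - u = x / √n`, where the moments of order about `2 n` tend to
  `exp (-3 x ^ 2)` (`tendsto_gaussMoment_outer`), a large deviation effect that a Gaussian change of
  measure makes visible, and those of order about `n` tend to `0`. The part of `V_2` with `F''` does
  not contribute, since the derivatives of the moments in the mean and in the variance cancel to
  leading order (`dominatedLimit_var`).

The limits are Gamma integrals. For blocks of equal size the Hessian is the constant matrix
`∫ b_1 ^ 2 ≥ 0` plus `2 m ∫ b_0 b_2 + ∫ V_2` times the identity (`RegularTail.hessian_eq`). For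
`m ≥ 2` it is therefore positive definite exactly when this last number is positive, which the
limits decide on either side of `m / n ^ (1 + γ / 2) = C_V / (2 C_b)`. Positivity of `C_V` means
`μ_{K²,1} > 0` (`IsCDFKernel.muSq_one_pos`), and positivity of `C_b` for symmetric kernels follows
from the Cauchy–Schwarz bound `3 μ_{K²,1} ^ 2 ≤ μ_{K²,2}`.
-/

namespace DDEVD

noncomputable section

/-! ### Moments of a normal law as polynomials in its mean -/

/-- The polynomial in `u = F y` underlying `FY0`: the `N`-th moment of a normal law of mean `u` and
variance `u (1 - u) / n`. -/
def gaussMoment (n N : ℕ) (u : ℝ) : ℝ :=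
  ∑ k ∈ Finset.Icc 0 (N / 2), gaussWeight n N k * u ^ (N - k) * (1 - u) ^ k

theorem FY0_eq (F : ℝ → ℝ) (n N : ℕ) (y : ℝ) : FY0 F n N y = gaussMoment n N (F y) := rfl

theorem gaussWeight_succ {n : ℕ} (hn : n ≠ 0) (N k : ℕ) :
    ((k : ℝ) + 1) * gaussWeight n (N + 2) (k + 1)
      = ((N : ℝ) + 2) * ((N : ℝ) + 1) / (2 * n) * gaussWeight n N k := by
  have h1 : ((N + 2).choose (2 * k + 2) : ℝ) * (2 * k + 2)
      = (N + 2) * (N + 1).choose (2 * k + 1) := by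
    have := Nat.add_one_mul_choose_eq (N + 1) (2 * k + 1)
    exact_mod_cast this.symm
  have h2 : ((N + 1).choose (2 * k + 1) : ℝ) * (2 * k + 1) = (N + 1) * N.choose (2 * k) := by
    have := Nat.add_one_mul_choose_eq N (2 * k)
    exact_mod_cast this.symm
  have h3 : (Nat.doubleFactorial (2 * k + 1) : ℝ)
      = (2 * k + 1) * (Nat.doubleFactorial (2 * k - 1) : ℝ) := by
    rcases k with _ | k
    · simp
    · rw [show 2 * (k + 1) + 1 = (2 * k + 1) + 2 by ring, Nat.doubleFactorial_add_two,
        show 2 * (k + 1) - 1 = 2 * k + 1 by omega]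
      push_cast; ring
  have hn' : (n : ℝ) ≠ 0 := by exact_mod_cast hn
  unfold gaussWeight
  rw [show 2 * (k + 1) = 2 * k + 2 by ring, show 2 * k + 2 - 1 = 2 * k + 1 by omega, h3]
  have h4 : ((N + 2).choose (2 * k + 2) : ℝ) * (2 * k + 2) * (2 * k + 1)
      = (N + 2) * (N + 1) * N.choose (2 * k) := by
    rw [h1, mul_assoc, h2]; ring
  linear_combination ((Nat.doubleFactorial (2 * k - 1) : ℝ) / (2 * (n : ℝ) ^ (k + 1))) * h4

theorem gaussWeight_eq_zero (n : ℕ) {N k : ℕ} (h : N < 2 * k) : gaussWeight n N k = 0 := by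
  simp [gaussWeight, Nat.choose_eq_zero_of_lt h]

theorem gaussMoment_eq_sum_range (n N : ℕ) {M : ℕ} (hM : N / 2 < M) (u : ℝ) :
    gaussMoment n N u = ∑ k ∈ Finset.range M, gaussWeight n N k * u ^ (N - k) * (1 - u) ^ k := by
  refine Finset.sum_subset (fun k hk => ?_) (fun k _ hk => ?_)
  · simp only [Finset.mem_Icc, Finset.mem_range] at *; omega
  · rw [gaussWeight_eq_zero n (by simp only [Finset.mem_Icc] at hk; omega)]; simp

theorem sum_Icc_succ (g : ℕ → ℝ) (a M : ℕ) :
    ∑ k ∈ Finset.Icc (a + 1) (M + 1), g k = ∑ k ∈ Finset.Icc a M, g (k + 1) := by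
  rw [← Finset.map_add_right_Icc, Finset.sum_map]
  rfl

/-- The weighted sum of `FY1` and `FY2beta` is again a Gaussian moment, of order lower by two. -/
theorem sum_mul_gaussWeight {n : ℕ} (hn : n ≠ 0) (N : ℕ) (u : ℝ) :
    ∑ k ∈ Finset.Icc 1 (N / 2),
      (k : ℝ) * gaussWeight n N k * u ^ (N - k - 1) * (1 - u) ^ (k - 1)
      = (N : ℝ) * (N - 1) / (2 * n) * gaussMoment n (N - 2) u := by
  rcases N with _ | _ | N
  · simp
  · simp
  · rw [show (N + 1 + 1) / 2 = N / 2 + 1 by omega, sum_Icc_succ _ 0, gaussMoment,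
      show N + 1 + 1 - 2 = N by omega, Finset.mul_sum]
    refine Finset.sum_congr rfl fun k _ => ?_
    have := gaussWeight_succ hn N k
    rw [show N + 1 + 1 - (k + 1) - 1 = N - k by omega, show k + 1 - 1 = k by omega]
    push_cast at *
    rw [show N + 1 + 1 = N + 2 by ring, this]
    ring

/-- The weighted sum of `FY2alpha` is a Gaussian moment of order lower by four. -/
theorem sum_mul_mul_gaussWeight {n : ℕ} (hn : n ≠ 0) (N : ℕ) (u : ℝ) :
    ∑ k ∈ Finset.Icc 2 (N / 2),
      ((k : ℝ) * ((k : ℝ) - 1) / 2) * gaussWeight n N k * u ^ (N - k - 2) * (1 - u) ^ (k - 2)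
      = (N : ℝ) * (N - 1) * (N - 2) * (N - 3) / (8 * n ^ 2) * gaussMoment n (N - 4) u := by
  rcases N with _ | _ | N
  · simp
  · simp
  · have h := sum_mul_gaussWeight hn N u
    rw [show (N + 1 + 1) / 2 = N / 2 + 1 by omega, sum_Icc_succ _ 1,
      show N + 1 + 1 - 4 = N - 2 by omega]
    have : (((N + 1 + 1 : ℕ) : ℝ)) * ((N + 1 + 1 : ℕ) - 1) * ((N + 1 + 1 : ℕ) - 2)
        * ((N + 1 + 1 : ℕ) - 3) / (8 * n ^ 2) * gaussMoment n (N - 2) u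
        = ((N : ℝ) + 2) * (N + 1) / (4 * n) *
          ((N : ℝ) * (N - 1) / (2 * n) * gaussMoment n (N - 2) u) := by
      push_cast; field_simp; ring
    rw [this, ← h, Finset.mul_sum]
    refine Finset.sum_congr rfl fun k _ => ?_
    have hw := gaussWeight_succ hn N k
    rw [show N + 1 + 1 - (k + 1) - 2 = N - k - 1 by omega, show k + 1 - 2 = k - 1 by omega]
    push_cast at *
    rw [show N + 1 + 1 = N + 2 by ring]
    linear_combination ((k : ℝ) / 2 * u ^ (N - k - 1) * (1 - u) ^ (k - 1)) * hw

/-- The derivative of the moment of order `N` in the mean is `N` times the one of order `N - 1`,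
its derivative in the variance is `N (N - 1) / 2` times the one of order `N - 2`; here the variance
is `u (1 - u) / n`. -/
theorem hasDerivAt_gaussMoment {n : ℕ} (hn : n ≠ 0) (N : ℕ) (u : ℝ) :
    HasDerivAt (gaussMoment n N)
      (N * gaussMoment n (N - 1) u
        + (1 - 2 * u) * ((N : ℝ) * (N - 1) / (2 * n)) * gaussMoment n (N - 2) u) u := by
  have key : ∀ k ∈ Finset.Icc 0 (N / 2), HasDerivAt
      (fun u : ℝ => gaussWeight n N k * u ^ (N - k) * (1 - u) ^ k)
      (N * (gaussWeight n (N - 1) k * u ^ (N - 1 - k) * (1 - u) ^ k)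
        + (1 - 2 * u) * ((k : ℝ) * gaussWeight n N k * u ^ (N - k - 1) * (1 - u) ^ (k - 1))) u := by
    intro k hk
    have hk' : 2 * k ≤ N := by simp only [Finset.mem_Icc] at hk; omega
    have h0 : HasDerivAt (fun u : ℝ => 1 - u) (-1) u := by
      simpa using (hasDerivAt_id u).const_sub 1
    have h1 := (((hasDerivAt_pow (N - k) u).const_mul (gaussWeight n N k)).mul (h0.pow k))
    refine h1.congr_deriv ?_
    have hw : ((N : ℝ) - 2 * k) * gaussWeight n N k = N * gaussWeight n (N - 1) k := by
      unfold gaussWeight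
      rcases N with _ | N
      · have : k = 0 := by omega
        subst this; simp
      · have hch := Nat.choose_mul_succ_eq N (2 * k)
        have h2 : ((N.choose (2 * k) : ℝ)) * (N + 1)
            = ((N + 1).choose (2 * k) : ℝ) * ((N : ℝ) + 1 - 2 * k) := by
          have h3 : ((N + 1 - 2 * k : ℕ) : ℝ) = (N : ℝ) + 1 - 2 * k := by
            rw [Nat.cast_sub hk']; push_cast; ring
          rw [← h3]; exact_mod_cast hch
        simp only [Nat.add_sub_cancel]
        push_cast
        linear_combination (-(Nat.doubleFactorial (2 * k - 1) : ℝ) / (n : ℝ) ^ k) * h2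
    have hc : ((N - k : ℕ) : ℝ) = N - k := by rw [Nat.cast_sub (by omega)]
    rw [hc, show N - 1 - k = N - k - 1 by omega, ← mul_assoc (N : ℝ), ← mul_assoc (N : ℝ), ← hw]
    rcases k with _ | k
    · simp; ring
    · have : u ^ (N - (k + 1)) = u ^ (N - (k + 1) - 1) * u := by
        rw [← pow_succ]; congr 1; omega
      rw [this]
      simp only [Nat.add_sub_cancel, Pi.pow_apply, pow_succ (1 - u) k]
      push_cast
      ring
  have h := HasDerivAt.fun_sum key
  refine h.congr_deriv ?_
  rw [Finset.sum_add_distrib, ← Finset.mul_sum, ← Finset.mul_sum]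
  have e1 : gaussMoment n (N - 1) u = ∑ k ∈ Finset.Icc 0 (N / 2),
      gaussWeight n (N - 1) k * u ^ (N - 1 - k) * (1 - u) ^ k := by
    rw [gaussMoment_eq_sum_range n (N - 1) (M := N / 2 + 1) (by omega)]
    refine Finset.sum_congr (by ext; simp) fun _ _ => rfl
  have e2 : ∑ k ∈ Finset.Icc 0 (N / 2),
      (k : ℝ) * gaussWeight n N k * u ^ (N - k - 1) * (1 - u) ^ (k - 1)
      = ∑ k ∈ Finset.Icc 1 (N / 2),
      (k : ℝ) * gaussWeight n N k * u ^ (N - k - 1) * (1 - u) ^ (k - 1) := by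
    symm
    refine Finset.sum_subset (Finset.Icc_subset_Icc_left (by omega)) fun k hk hk' => ?_
    have : k = 0 := by simp only [Finset.mem_Icc] at *; omega
    subst this; simp
  rw [e1, e2, sum_mul_gaussWeight hn]
  ring

theorem continuous_gaussMoment (n N : ℕ) : Continuous (gaussMoment n N) := by
  unfold gaussMoment; fun_prop

/-! ### Gaussian integrals and bounds on the moments -/

theorem integrable_pow_gaussianReal (N : ℕ) :
    Integrable (fun g : ℝ => g ^ N) (gaussianReal 0 1) := by
  rcases N with _ | N
  · simp
  · have h := (memLp_id_gaussianReal (μ := 0) (v := 1) ((N + 1 : ℕ) : NNReal)).integrable_norm_pow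
      (Nat.succ_ne_zero N)
    refine h.mono' (by fun_prop) (Eventually.of_forall fun x => ?_)
    simp

theorem gaussianPDFReal_std (x : ℝ) :
    gaussianPDFReal 0 1 x = (√(2 * Real.pi))⁻¹ * Real.exp (-x ^ 2 / 2) := by
  simp [gaussianPDFReal]

theorem integral_gaussianReal_std (ψ : ℝ → ℝ) :
    ∫ g, ψ g ∂(gaussianReal 0 1)
      = (√(2 * Real.pi))⁻¹ * ∫ x : ℝ, Real.exp (-x ^ 2 / 2) * ψ x := by
  rw [integral_gaussianReal_eq_integral_smul one_ne_zero, ← integral_const_mul]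
  simp only [gaussianPDFReal_std, smul_eq_mul, mul_assoc]

theorem integrable_pow_mul_exp_neg_sq (N : ℕ) :
    Integrable (fun x : ℝ => x ^ N * Real.exp (-x ^ 2 / 2)) := by
  have h := integrable_rpow_mul_exp_neg_mul_sq (b := 1 / 2) (by norm_num) (s := N)
    (by have : (0 : ℝ) ≤ N := by positivity
        linarith)
  refine h.congr (Eventually.of_forall fun x => ?_)
  simp only [Real.rpow_natCast]
  congr 2; ring

/-- Integration by parts against the standard normal density. -/
theorem integral_pow_add_two_gaussianReal (N : ℕ) :
    ∫ g, g ^ (N + 2) ∂(gaussianReal 0 1) = (N + 1) * ∫ g, g ^ N ∂(gaussianReal 0 1) := by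
  rw [integral_gaussianReal_std, integral_gaussianReal_std]
  have hd : ∀ x : ℝ, HasDerivAt (fun x : ℝ => x ^ (N + 1) * Real.exp (-x ^ 2 / 2))
      ((N + 1) * (x ^ N * Real.exp (-x ^ 2 / 2)) - x ^ (N + 2) * Real.exp (-x ^ 2 / 2)) x := by
    intro x
    have h1 : HasDerivAt (fun x : ℝ => -x ^ 2 / 2) (-x) x := by
      refine (((hasDerivAt_pow 2 x).neg).div_const 2).congr_deriv ?_
      push_cast; ring
    refine ((hasDerivAt_pow (N + 1) x).mul h1.exp).congr_deriv ?_
    rw [Nat.add_sub_cancel]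
    push_cast
    ring
  have h0 := integral_eq_zero_of_hasDerivAt_of_integrable hd
    (((integrable_pow_mul_exp_neg_sq N).const_mul _).sub (integrable_pow_mul_exp_neg_sq (N + 2)))
    (integrable_pow_mul_exp_neg_sq (N + 1))
  rw [integral_sub ((integrable_pow_mul_exp_neg_sq N).const_mul _)
    (integrable_pow_mul_exp_neg_sq (N + 2)), integral_const_mul] at h0
  simp only [mul_comm (Real.exp _)]
  linear_combination (-(√(2 * Real.pi))⁻¹) * h0

theorem integral_pow_odd_gaussianReal (k : ℕ) :
    ∫ g, g ^ (2 * k + 1) ∂(gaussianReal 0 1) = 0 := by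
  induction k with
  | zero => simp [integral_id_gaussianReal]
  | succ k ih =>
    rw [show 2 * (k + 1) + 1 = (2 * k + 1) + 2 by ring, integral_pow_add_two_gaussianReal, ih,
      mul_zero]

theorem integral_pow_even_gaussianReal (k : ℕ) :
    ∫ g, g ^ (2 * k) ∂(gaussianReal 0 1) = (Nat.doubleFactorial (2 * k - 1) : ℝ) := by
  induction k with
  | zero => simp
  | succ k ih =>
    rw [show 2 * (k + 1) = 2 * k + 2 by ring, integral_pow_add_two_gaussianReal, ih]
    rcases k with _ | k
    · simp
    · rw [show 2 * (k + 1) + 2 - 1 = (2 * k + 1) + 2 by omega, Nat.doubleFactorial_add_two,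
        show 2 * (k + 1) - 1 = 2 * k + 1 by omega]
      push_cast; ring

/-- `gaussMoment n N u` is the `N`-th moment of a normal law of mean `u` and variance
`u (1 - u) / n`. -/
theorem gaussMoment_eq_integral (n N : ℕ) {u : ℝ} (hu0 : 0 ≤ u) (hu1 : u ≤ 1) :
    gaussMoment n N u = ∫ g, (u + √(u * (1 - u) / n) * g) ^ N ∂(gaussianReal 0 1) := by
  set σ := √(u * (1 - u) / n) with hσ
  have hσ2 : σ ^ 2 = u * (1 - u) / n :=
    Real.sq_sqrt (div_nonneg (mul_nonneg hu0 (by linarith)) (Nat.cast_nonneg n))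
  have h1 : ∀ g : ℝ, (u + σ * g) ^ N
      = ∑ m ∈ Finset.range (N + 1), (σ ^ m * u ^ (N - m) * N.choose m) * g ^ m := by
    intro g
    rw [add_comm, add_pow]
    refine Finset.sum_congr rfl fun m _ => ?_
    rw [mul_pow]; ring
  simp only [h1]
  rw [integral_finsetSum _ fun m _ => (integrable_pow_gaussianReal m).const_mul _, gaussMoment]
  simp only [integral_const_mul]
  refine Finset.sum_of_injOn (fun k => 2 * k) (fun a _ b _ h => by simpa using h) ?_ ?_ ?_
  · intro k hk
    simp only [Finset.coe_Icc, Set.mem_Icc, Finset.coe_range, Set.mem_Iio] at *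
    omega
  · intro m hm hm'
    rcases Nat.even_or_odd' m with ⟨k, rfl | rfl⟩
    · exfalso
      refine hm' ⟨k, ?_, rfl⟩
      simp only [Finset.coe_Icc, Set.mem_Icc, Finset.mem_range] at *
      omega
    · rw [integral_pow_odd_gaussianReal, mul_zero]
  · intro k hk
    have hk' : 2 * k ≤ N := by simp only [Finset.mem_Icc] at hk; omega
    rw [integral_pow_even_gaussianReal, pow_mul, hσ2, gaussWeight, div_pow, mul_pow,
      show N - k = N - 2 * k + k by omega, pow_add]
    ring

/-- Gaussian change of measure by the factor `exp (c (Z ^ 2 - 1))`, for `Z` normal of mean `u`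
and variance `σ ^ 2`: both the mean and the variance are divided by `1 - 2 c σ ^ 2`. -/
theorem integral_exp_sq_mul_gaussianReal (ψ : ℝ → ℝ) (u σ c : ℝ) (h : 0 < 1 - 2 * c * σ ^ 2) :
    ∫ g, Real.exp (c * ((u + σ * g) ^ 2 - 1)) * ψ (u + σ * g) ∂(gaussianReal 0 1)
      = Real.exp (c * u ^ 2 / (1 - 2 * c * σ ^ 2) - c) / √(1 - 2 * c * σ ^ 2)
        * ∫ g, ψ (u / (1 - 2 * c * σ ^ 2) + σ / √(1 - 2 * c * σ ^ 2) * g) ∂(gaussianReal 0 1) := by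
  set κ := 1 - 2 * c * σ ^ 2 with hκ
  have hk : 0 < √κ := Real.sqrt_pos.2 h
  have hk2 : √κ ^ 2 = κ := Real.sq_sqrt h.le
  set r := √κ with hr
  -- completing the square shifts the variable by `b` and scales it by `r⁻¹`
  set b := 2 * c * σ * u / κ with hb
  rw [integral_gaussianReal_std, integral_gaussianReal_std]
  set Φ : ℝ → ℝ := fun x => Real.exp (-x ^ 2 / 2)
    * (Real.exp (c * ((u + σ * x) ^ 2 - 1)) * ψ (u + σ * x)) with hΦ
  have h1 : ∫ x, Φ x = r⁻¹ * ∫ x, Φ (x * r⁻¹ + b) := by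
    rw [Measure.integral_comp_mul_right (fun x => Φ (x + b)) r⁻¹,
      integral_add_right_eq_self Φ b, inv_inv, abs_of_pos hk, smul_eq_mul, ← mul_assoc,
      inv_mul_cancel₀ hk.ne', one_mul]
  have h2 : ∀ x, Φ (x * r⁻¹ + b) = Real.exp (c * u ^ 2 / κ - c)
      * (Real.exp (-x ^ 2 / 2) * ψ (u / κ + σ / r * x)) := by
    intro x
    have e1 : u + σ * (x * r⁻¹ + b) = u / κ + σ / r * x := by
      rw [hb]
      have : u = u / κ - σ * (2 * c * σ * u / κ) := by
        field_simp; rw [hκ]; ring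
      rw [mul_add]
      linear_combination this
    have e2 : -(x * r⁻¹ + b) ^ 2 / 2 + c * ((u / κ + σ / r * x) ^ 2 - 1)
        = (c * u ^ 2 / κ - c) + -x ^ 2 / 2 := by
      rw [hb]
      have hx : c * σ ^ 2 = (1 - κ) / 2 := by rw [hκ]; ring
      have e3 : -(x * r⁻¹ + 2 * c * σ * u / κ) ^ 2 / 2 + c * ((u / κ + σ / r * x) ^ 2 - 1)
          = x ^ 2 * (c * σ ^ 2 - 1 / 2) / r ^ 2
            + (c * u ^ 2 - 2 * c * (c * σ ^ 2) * u ^ 2) / κ ^ 2 - c := by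
        field_simp; ring
      rw [e3, hx, hk2]
      field_simp; ring
    simp only [hΦ]
    rw [e1, ← mul_assoc, ← Real.exp_add, e2, Real.exp_add, mul_assoc]
  rw [h1]
  simp only [h2]
  rw [integral_const_mul]
  ring

theorem integrable_exp_mul_abs_gaussianReal (a : ℝ) :
    Integrable (fun g : ℝ => Real.exp (a * |g|)) (gaussianReal 0 1) := by
  refine ((integrable_exp_mul_gaussianReal (μ := 0) (v := 1) a).add
    (integrable_exp_mul_gaussianReal (μ := 0) (v := 1) (-a))).mono' (by fun_prop)
    (Eventually.of_forall fun g => ?_)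
  rw [Real.norm_eq_abs, Real.abs_exp]
  simp only [Pi.add_apply]
  rcases abs_cases g with ⟨h, _⟩ | ⟨h, _⟩ <;> rw [h]
  · linarith [Real.exp_pos (-a * g)]
  · rw [show a * -g = -a * g by ring]
    linarith [Real.exp_pos (a * g)]

theorem integral_exp_mul_gaussianReal (a : ℝ) :
    ∫ g, Real.exp (a * g) ∂(gaussianReal 0 1) = Real.exp (a ^ 2 / 2) := by
  have := congrFun (mgf_fun_id_gaussianReal (μ := 0) (v := 1)) a
  simpa [mgf] using this

/-- Exponential bound in `N (1 - u)` for the moments of order at most `n`; it comes from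
`|Z| ^ N ≤ exp (N (Z - 1)) + exp (-N (Z + 1))`. -/
theorem abs_gaussMoment_le_exp {n N : ℕ} (hn : n ≠ 0) (hN : N ≤ n) {u : ℝ} (hu0 : 0 ≤ u)
    (hu1 : u ≤ 1) : |gaussMoment n N u| ≤ 2 * Real.exp (-(N * (1 - u) / 2)) := by
  rw [gaussMoment_eq_integral n N hu0 hu1]
  set σ := √(u * (1 - u) / n) with hσ
  have hσ2 : σ ^ 2 = u * (1 - u) / n :=
    Real.sq_sqrt (div_nonneg (mul_nonneg hu0 (by linarith)) (Nat.cast_nonneg n))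
  have hn' : (0 : ℝ) < n := by exact_mod_cast Nat.pos_of_ne_zero hn
  have hNn : (N : ℝ) ≤ n := by exact_mod_cast hN
  have hN0 : (0 : ℝ) ≤ N := by positivity
  have hv : N ^ 2 * σ ^ 2 ≤ N * (1 - u) := by
    rw [hσ2]
    calc (N : ℝ) ^ 2 * (u * (1 - u) / n) = N * (1 - u) * (u * (N / n)) := by ring
      _ ≤ N * (1 - u) * 1 := by
        have : (N : ℝ) / n ≤ 1 := (div_le_one hn').2 hNn
        have h0 : 0 ≤ (N : ℝ) / n := by positivity
        refine mul_le_mul_of_nonneg_left ?_ (mul_nonneg hN0 (by linarith))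
        nlinarith
      _ = _ := mul_one _
  have hpt : ∀ g : ℝ, |(u + σ * g) ^ N|
      ≤ Real.exp (-(N * (1 - u))) * Real.exp ((N * σ) * g)
        + Real.exp (-(N * (1 + u))) * Real.exp ((-(N * σ)) * g) := by
    intro g
    rw [← Real.exp_add, ← Real.exp_add, abs_pow]
    have h1 : |u + σ * g| ^ N ≤ Real.exp (N * (|u + σ * g| - 1)) := by
      rw [Real.exp_nat_mul]
      refine pow_le_pow_left₀ (abs_nonneg _) ?_ _
      linarith [Real.add_one_le_exp (|u + σ * g| - 1)]
    refine h1.trans ?_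
    rcases abs_cases (u + σ * g) with ⟨h, _⟩ | ⟨h, _⟩ <;> rw [h]
    · rw [show N * (u + σ * g - 1) = -(N * (1 - u)) + N * σ * g by ring]
      linarith [Real.exp_pos (-(N * (1 + u)) + -(N * σ) * g)]
    · rw [show N * (-(u + σ * g) - 1) = -(N * (1 + u)) + -(N * σ) * g by ring]
      linarith [Real.exp_pos (-(N * (1 - u)) + (N * σ) * g)]
  have hi1 := integrable_exp_mul_gaussianReal (μ := 0) (v := 1) (N * σ)
  have hi2 := integrable_exp_mul_gaussianReal (μ := 0) (v := 1) (-(N * σ))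
  refine (abs_integral_le_integral_abs).trans ?_
  refine (integral_mono_of_nonneg (Eventually.of_forall fun g => abs_nonneg _)
    ((hi1.const_mul _).add (hi2.const_mul _)) (Eventually.of_forall hpt)).trans ?_
  simp only [Pi.add_apply]
  rw [integral_add (hi1.const_mul _) (hi2.const_mul _), integral_const_mul, integral_const_mul,
    integral_exp_mul_gaussianReal, integral_exp_mul_gaussianReal, ← Real.exp_add, ← Real.exp_add,
    two_mul]
  have hNu : 0 ≤ N * u := mul_nonneg hN0 hu0
  refine add_le_add (Real.exp_le_exp.2 ?_) (Real.exp_le_exp.2 ?_)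
  · rw [mul_pow]; linarith
  · rw [neg_sq, mul_pow]; linarith

/-- Exponential bound in `N (1 - u) ^ 2` for the moments of order at most `2 n`; it comes from
`|Z| ≤ exp ((Z ^ 2 - 1) / 2)`. -/
theorem abs_gaussMoment_le_exp_sq {n N : ℕ} (hn : n ≠ 0) (hN : N ≤ 2 * n) {u : ℝ} (hu0 : 0 ≤ u)
    (hu1 : u ≤ 1) : |gaussMoment n N u| ≤ 2 * Real.exp (-(N * (1 - u) ^ 2 / 2)) := by
  rw [gaussMoment_eq_integral n N hu0 hu1]
  set σ := √(u * (1 - u) / n) with hσ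
  have hσ2 : σ ^ 2 = u * (1 - u) / n :=
    Real.sq_sqrt (div_nonneg (mul_nonneg hu0 (by linarith)) (Nat.cast_nonneg n))
  have hn' : (0 : ℝ) < n := by exact_mod_cast Nat.pos_of_ne_zero hn
  have hNn : (N : ℝ) ≤ 2 * n := by exact_mod_cast hN
  have hN0 : (0 : ℝ) ≤ N := by positivity
  set θ := 2 * ((N : ℝ) / 2) * σ ^ 2 with hθ
  have hut : 0 ≤ u * (1 - u) := mul_nonneg hu0 (by linarith)
  have hθ1 : θ ≤ 2 * (u * (1 - u)) := by
    rw [hθ, hσ2]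
    calc 2 * ((N : ℝ) / 2) * (u * (1 - u) / n) = (u * (1 - u)) * (N / n) := by ring
      _ ≤ (u * (1 - u)) * 2 := mul_le_mul_of_nonneg_left ((div_le_iff₀ hn').2 hNn) hut
      _ = _ := by ring
  have hθ0 : 0 ≤ θ := by positivity
  have hθ2 : θ ≤ 1 / 2 := by nlinarith [sq_nonneg (2 * u - 1)]
  have hκ : 0 < 1 - θ := by linarith
  have htilt := integral_exp_sq_mul_gaussianReal (fun _ => 1) u σ (N / 2) hκ
  simp only [mul_one, integral_const, probReal_univ, smul_eq_mul] at htilt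
  rw [← hθ] at htilt
  have hpt : ∀ g : ℝ, |(u + σ * g) ^ N| ≤ Real.exp (N / 2 * ((u + σ * g) ^ 2 - 1)) := by
    intro g
    rw [abs_pow, show (N : ℝ) / 2 * ((u + σ * g) ^ 2 - 1)
      = N * (((u + σ * g) ^ 2 - 1) / 2) by ring, Real.exp_nat_mul]
    refine pow_le_pow_left₀ (abs_nonneg _) ?_ _
    refine abs_le_of_sq_le_sq ?_ (Real.exp_pos _).le
    rw [← Real.exp_nat_mul]
    have := Real.add_one_le_exp ((u + σ * g) ^ 2 - 1)
    rw [show ((2 : ℕ) : ℝ) * (((u + σ * g) ^ 2 - 1) / 2) = (u + σ * g) ^ 2 - 1 by push_cast; ring]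
    linarith
  have hpos : 0 < ∫ g, Real.exp (N / 2 * ((u + σ * g) ^ 2 - 1)) ∂(gaussianReal 0 1) := by
    rw [htilt]; positivity
  -- a nonzero integral is not the default value for functions that are not integrable
  have hint : Integrable (fun g => Real.exp (N / 2 * ((u + σ * g) ^ 2 - 1))) (gaussianReal 0 1) :=
    by_contra fun h => hpos.ne' (integral_undef h)
  refine (abs_integral_le_integral_abs).trans ?_
  refine (integral_mono_of_nonneg (Eventually.of_forall fun g => abs_nonneg _)
    hint (Eventually.of_forall hpt)).trans ?_
  rw [htilt, div_eq_mul_inv, mul_comm]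
  have hs : 1 / 2 ≤ √(1 - θ) := Real.le_sqrt_of_sq_le (by linarith)
  refine mul_le_mul ?_ (Real.exp_le_exp.2 ?_) (Real.exp_pos _).le (by norm_num)
  · rw [inv_le_comm₀ (by linarith) (by norm_num)]; linarith
  · have h1 : u ^ 2 / (1 - θ) ≤ 1 - (1 - u) ^ 2 := by
      rw [div_le_iff₀ hκ]
      have : u ^ 2 ≤ 1 - (1 - u) ^ 2 - θ := by nlinarith
      nlinarith [mul_nonneg hθ0 (sq_nonneg (1 - u))]
    have h2 := mul_le_mul_of_nonneg_left h1 (by positivity : 0 ≤ (N : ℝ) / 2)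
    rw [mul_div_assoc]
    linarith

/-! ### Limits of the moments near the right endpoint -/

theorem tendsto_pow_sub_of_tendsto_pow {z : ℕ → ℝ} {L : ℝ} (hz : Tendsto z atTop (𝓝 1))
    (h : Tendsto (fun n => z n ^ n) atTop (𝓝 L)) (j : ℕ) :
    Tendsto (fun n => z n ^ (n - j)) atTop (𝓝 L) := by
  have h1 : Tendsto (fun n => z n ^ n / z n ^ j) atTop (𝓝 (L / 1 ^ j)) :=
    h.div (hz.pow j) (by simp)
  rw [one_pow, div_one] at h1
  refine h1.congr' ?_
  filter_upwards [eventually_ge_atTop j, hz.eventually_ne one_ne_zero] with n hn h0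
  rw [pow_sub₀ _ h0 hn, div_eq_mul_inv]

/-- At the scale `1 - u ∼ x / n`, the moments of order `n - j` of a normal law of mean `u` and
variance `u (1 - u) / n` converge to `E exp (-x + √x g) = exp (-x / 2)`, with `g` standard
normal. -/
theorem tendsto_gaussMoment_inner (j : ℕ) {x : ℝ} (hx : 0 < x) :
    Tendsto (fun n : ℕ => gaussMoment n (n - j) (1 - x / n)) atTop (𝓝 (Real.exp (-(x / 2)))) := by
  set u : ℕ → ℝ := fun n => 1 - x / n with hu
  set δ : ℕ → ℝ → ℝ := fun n g => -(x / n) + √(u n * (1 - u n) / n) * g with hδ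
  have hu1 : Tendsto u atTop (𝓝 1) := by
    simpa using (tendsto_const_div_atTop_nhds_zero_nat x).const_sub 1
  have hgood : ∀ᶠ n : ℕ in atTop, 0 < n ∧ 0 ≤ u n ∧ u n ≤ 1 := by
    filter_upwards [eventually_gt_atTop 0, hu1.eventually_const_le zero_lt_one] with n hn h0
    refine ⟨hn, h0, ?_⟩
    have : 0 ≤ x / n := by positivity
    simp only [hu]; linarith
  have hnσ : ∀ n : ℕ, 0 < n → (n : ℝ) * √(u n * (1 - u n) / n) = √(u n * x) := by
    intro n hn
    have hn' : (0 : ℝ) < n := by exact_mod_cast hn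
    rw [← Real.sqrt_sq hn'.le, ← Real.sqrt_mul (sq_nonneg _), Real.sqrt_sq hn'.le]
    congr 1
    simp only [hu]
    field_simp; ring
  have hlim : ∀ g : ℝ, Tendsto (fun n : ℕ => (n : ℝ) * δ n g) atTop (𝓝 (-x + √x * g)) := by
    intro g
    have h1 : Tendsto (fun n => -x + √(u n * x) * g) atTop (𝓝 (-x + √x * g)) := by
      have := (Real.continuous_sqrt.tendsto _).comp (hu1.mul_const x)
      rw [one_mul] at this
      exact (this.mul_const g).const_add _
    refine h1.congr' ?_
    filter_upwards [hgood] with n hn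
    have hn' : (n : ℝ) ≠ 0 := by exact_mod_cast hn.1.ne'
    rw [← hnσ n hn.1]
    simp only [hδ]
    field_simp
  have hlim1 : ∀ g : ℝ, Tendsto (fun n : ℕ => (1 + δ n g) ^ (n - j)) atTop
      (𝓝 (Real.exp (-x + √x * g))) := by
    intro g
    refine tendsto_pow_sub_of_tendsto_pow ?_ (Real.tendsto_one_add_pow_exp_of_tendsto (hlim g)) j
    have h0 := (hlim g).mul (tendsto_inv_atTop_nhds_zero_nat (𝕜 := ℝ))
    rw [mul_zero] at h0
    have h2 : Tendsto (fun n => δ n g) atTop (𝓝 0) := by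
      refine h0.congr' ?_
      filter_upwards [eventually_gt_atTop 0] with n hn
      have hn' : (n : ℝ) ≠ 0 := by exact_mod_cast hn.ne'
      field_simp
    simpa using h2.const_add 1
  have key := tendsto_integral_filter_of_dominated_convergence (μ := gaussianReal 0 1)
    (F := fun n g => (1 + δ n g) ^ (n - j)) (l := atTop)
    (fun g => Real.exp x * Real.exp (√x * |g|))
    (Eventually.of_forall fun n => by
      refine Continuous.aestronglyMeasurable ?_
      simp only [hδ]; fun_prop)
    (by
      filter_upwards [hgood] with n hn
      refine Eventually.of_forall fun g => ?_
      have hn' : (0 : ℝ) < n := by exact_mod_cast hn.1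
      rw [norm_pow, Real.norm_eq_abs]
      have h1 : |1 + δ n g| ≤ Real.exp |δ n g| := by
        refine (abs_add_le _ _).trans ?_
        rw [abs_one]
        linarith [Real.add_one_le_exp |δ n g|]
      refine (pow_le_pow_left₀ (abs_nonneg _) h1 _).trans ?_
      rw [← Real.exp_nat_mul, ← Real.exp_add]
      refine Real.exp_le_exp.2 ?_
      have h2 : ((n - j : ℕ) : ℝ) ≤ n := by exact_mod_cast Nat.sub_le n j
      refine (mul_le_mul_of_nonneg_right h2 (abs_nonneg _)).trans ?_
      have h3 : (n : ℝ) * δ n g = -x + √(u n * x) * g := by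
        rw [← hnσ n hn.1]
        simp only [hδ]
        field_simp
      have h4 : (n : ℝ) * |δ n g| = |(n : ℝ) * δ n g| := by rw [abs_mul, abs_of_pos hn']
      rw [h4, h3]
      refine (abs_add_le _ _).trans ?_
      rw [abs_neg, abs_of_pos hx, abs_mul, abs_of_nonneg (Real.sqrt_nonneg _)]
      have : √(u n * x) ≤ √x := Real.sqrt_le_sqrt (by nlinarith [hn.2.2])
      nlinarith [abs_nonneg g])
    ((integrable_exp_mul_abs_gaussianReal _).const_mul _)
    (Eventually.of_forall hlim1)
  have hval : ∫ g, Real.exp (-x + √x * g) ∂(gaussianReal 0 1) = Real.exp (-(x / 2)) := by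
    simp only [Real.exp_add]
    rw [integral_const_mul, integral_exp_mul_gaussianReal, Real.sq_sqrt hx.le, ← Real.exp_add]
    congr 1; ring
  rw [hval] at key
  refine key.congr' ?_
  filter_upwards [hgood] with n hn
  change _ = gaussMoment n (n - j) (u n)
  rw [gaussMoment_eq_integral n (n - j) hn.2.1 hn.2.2]
  refine integral_congr_ae (Eventually.of_forall fun g => ?_)
  simp only [hδ, hu]
  congr 1; ring

/-- The function `z exp ((1 - z ^ 2) / 2)` has its maximum `1` at `z = 1`, where its logarithm is
`-(z - 1) ^ 2` up to third order. -/
theorem tendsto_mul_exp_pow {δ : ℕ → ℝ} {x : ℝ}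
    (h : Tendsto (fun n : ℕ => √(n : ℝ) * δ n) atTop (𝓝 x)) (h0 : Tendsto δ atTop (𝓝 0)) :
    Tendsto (fun n : ℕ => ((1 + δ n) * Real.exp ((1 - (1 + δ n) ^ 2) / 2)) ^ n) atTop
      (𝓝 (Real.exp (-x ^ 2))) := by
  have hsq : Tendsto (fun n : ℕ => (n : ℝ) * δ n ^ 2) atTop (𝓝 (x ^ 2)) := by
    refine (h.pow 2).congr fun n => ?_
    rw [mul_pow, Real.sq_sqrt (Nat.cast_nonneg n)]
  have hsmall : ∀ᶠ n in atTop, |δ n| < 1 / 2 := by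
    have := h0.abs
    rw [abs_zero] at this
    exact this.eventually_lt_const (by norm_num)
  have hrem : Tendsto (fun n : ℕ => (n : ℝ) * (-δ n + δ n ^ 2 / 2 + Real.log (1 + δ n))) atTop
      (𝓝 0) := by
    have hb : Tendsto (fun n : ℕ => (n : ℝ) * δ n ^ 2 * |δ n| * 2) atTop (𝓝 0) := by
      have := (hsq.mul h0.abs).mul_const 2
      simpa using this
    refine squeeze_zero_norm' ?_ hb
    filter_upwards [hsmall] with n hn
    have h1 := Real.abs_log_sub_add_sum_range_le (x := -δ n) (by rw [abs_neg]; linarith) 2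
    simp only [Finset.sum_range_succ, Finset.sum_range_zero, abs_neg] at h1
    norm_num at h1
    rw [norm_mul, Real.norm_natCast, Real.norm_eq_abs]
    have h2 : |δ n| ^ 3 / (1 - |δ n|) ≤ δ n ^ 2 * |δ n| * 2 := by
      rw [div_le_iff₀ (by linarith), ← sq_abs]
      nlinarith [pow_nonneg (abs_nonneg (δ n)) 3]
    calc (n : ℝ) * |-δ n + δ n ^ 2 / 2 + Real.log (1 + δ n)|
        ≤ n * (δ n ^ 2 * |δ n| * 2) := mul_le_mul_of_nonneg_left (h1.trans h2) (Nat.cast_nonneg n)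
      _ = _ := by ring
  have hexp := (Real.continuous_exp.tendsto _).comp (hrem.sub hsq)
  rw [zero_sub] at hexp
  refine hexp.congr' ?_
  filter_upwards [hsmall] with n hn
  have hpos : 0 < 1 + δ n := by linarith [(abs_lt.1 hn).1]
  conv_rhs => rw [← Real.exp_log hpos, ← Real.exp_add, ← Real.exp_nat_mul]
  simp only [Function.comp]
  rw [Real.exp_log hpos]
  congr 1
  ring

theorem abs_mul_exp_le_one (z : ℝ) : |z * Real.exp ((1 - z ^ 2) / 2)| ≤ 1 := by
  refine abs_le_of_sq_le_sq ?_ zero_le_one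
  rw [mul_pow, ← Real.exp_nat_mul, one_pow]
  have h := Real.add_one_le_exp (z ^ 2 - 1)
  calc z ^ 2 * Real.exp (((2 : ℕ) : ℝ) * ((1 - z ^ 2) / 2))
      ≤ Real.exp (z ^ 2 - 1) * Real.exp (((2 : ℕ) : ℝ) * ((1 - z ^ 2) / 2)) :=
        mul_le_mul_of_nonneg_right (by linarith) (Real.exp_pos _).le
    _ = 1 := by rw [← Real.exp_add]; push_cast; ring_nf; exact Real.exp_zero

/-- At the scale `1 - u ∼ x / √n`, the moments of order `2 n - j` of a normal law of mean `u` and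
variance `u (1 - u) / n` converge to `exp (-3 x ^ 2)`. The change of measure by
`exp (N (Z ^ 2 - 1) / 2)` contributes `exp (-x ^ 2)`. It moves the mean from `1 - x / √n` to about
`1 + x / √n`, where the remaining factor `(Z exp ((1 - Z ^ 2) / 2)) ^ N`, which is bounded by one,
is about `exp (-2 x ^ 2)`. -/
theorem tendsto_gaussMoment_outer (j : ℕ) {x : ℝ} (hx : 0 < x) :
    Tendsto (fun n : ℕ => gaussMoment n (2 * n - j) (1 - x / √n)) atTop
      (𝓝 (Real.exp (-(3 * x ^ 2)))) := by
  set t : ℕ → ℝ := fun n => x / √n with ht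
  set u : ℕ → ℝ := fun n => 1 - t n with hu
  set ν : ℕ → ℝ := fun n => ((2 * n - j : ℕ) : ℝ) / n with hν
  set κ : ℕ → ℝ := fun n => 1 - ν n * (u n * t n) with hκ
  set σ : ℕ → ℝ := fun n => √(u n * (1 - u n) / n) with hσ
  set δ : ℕ → ℝ → ℝ := fun n g => u n / κ n - 1 + σ n / √(κ n) * g with hδ
  have hsqrt : Tendsto (fun n : ℕ => √(n : ℝ)) atTop atTop :=
    Real.tendsto_sqrt_atTop.comp tendsto_natCast_atTop_atTop
  have ht0 : Tendsto t atTop (𝓝 0) := hsqrt.const_div_atTop x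
  have hu1 : Tendsto u atTop (𝓝 1) := by simpa using ht0.const_sub 1
  have hνj : ∀ᶠ n : ℕ in atTop, 0 < n ∧ ν n = 2 - j / n := by
    filter_upwards [eventually_gt_atTop 0, eventually_ge_atTop j] with n hn hj
    refine ⟨hn, ?_⟩
    have hn' : (n : ℝ) ≠ 0 := by exact_mod_cast hn.ne'
    simp only [hν]
    rw [Nat.cast_sub (by omega)]
    push_cast
    field_simp
  have hν2 : Tendsto ν atTop (𝓝 2) := by
    have : Tendsto (fun n : ℕ => 2 - (j : ℝ) / n) atTop (𝓝 2) := by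
      simpa using (tendsto_const_div_atTop_nhds_zero_nat (j : ℝ)).const_sub 2
    exact this.congr' (hνj.mono fun n hn => hn.2.symm)
  have hut : Tendsto (fun n => u n * t n) atTop (𝓝 0) := by simpa using hu1.mul ht0
  have hκ1 : Tendsto κ atTop (𝓝 1) := by
    simpa using (hν2.mul hut).const_sub 1
  have hgood : ∀ᶠ n : ℕ in atTop, 0 < n ∧ 0 ≤ u n ∧ u n ≤ 1 ∧ 0 < κ n ∧ ν n = 2 - j / n := by
    filter_upwards [hνj, hu1.eventually_const_le zero_lt_one,
      hκ1.eventually_const_lt zero_lt_one] with n hn h0 h1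
    refine ⟨hn.1, h0, ?_, h1, hn.2⟩
    have : 0 ≤ t n := by positivity
    simp only [hu]; linarith
  -- the exponential factor of the change of measure
  have hfac : Tendsto (fun n => Real.exp (((2 * n - j : ℕ) : ℝ) / 2 * u n ^ 2 / κ n
      - ((2 * n - j : ℕ) : ℝ) / 2) / √(κ n)) atTop (𝓝 (Real.exp (-x ^ 2))) := by
    have h1 : Tendsto (fun n => ν n / 2 * (-x ^ 2 - j * (u n * t n)) / κ n) atTop
        (𝓝 (-x ^ 2)) := by
      have := ((hν2.div_const 2).mul ((hut.const_mul (j : ℝ)).const_sub (-x ^ 2))).div hκ1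
        one_ne_zero
      simpa [Pi.div_def] using this
    have h2 : Tendsto (fun n => √(κ n)) atTop (𝓝 1) := by
      simpa [Function.comp_def] using (Real.continuous_sqrt.tendsto _).comp hκ1
    have h3 := ((Real.continuous_exp.tendsto _).comp h1).div h2 one_ne_zero
    rw [div_one] at h3
    refine h3.congr' ?_
    filter_upwards [hgood] with n ⟨hn, _, _, hk, hnu⟩
    have hn' : (0 : ℝ) < n := by exact_mod_cast hn
    have hN : ((2 * n - j : ℕ) : ℝ) = ν n * n := by
      simp only [hν]; field_simp
    have hxt : x ^ 2 = n * t n ^ 2 := by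
      simp only [ht]
      rw [div_pow, Real.sq_sqrt hn'.le]; field_simp
    have hj : (j : ℝ) = (2 - ν n) * n := by rw [hnu]; field_simp; ring
    change Real.exp (ν n / 2 * (-x ^ 2 - j * (u n * t n)) / κ n) / √(κ n) = _
    congr 2
    rw [hN, hxt, hj]
    have hk' : κ n = 1 - ν n * (u n * t n) := rfl
    have hu' : u n = 1 - t n := rfl
    field_simp
    rw [hk', hu']
    ring
  -- the tilted mean
  have hδx : ∀ g, Tendsto (fun n : ℕ => √(n : ℝ) * δ n g) atTop (𝓝 x) := by
    intro g
    have h1 : Tendsto (fun n => x * (ν n * u n - 1) / κ n + √(u n * t n) / √(κ n) * g) atTop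
        (𝓝 x) := by
      have h2 : Tendsto (fun n => √(κ n)) atTop (𝓝 1) := by
        simpa [Function.comp_def] using (Real.continuous_sqrt.tendsto _).comp hκ1
      have h4 : Tendsto (fun n => √(u n * t n)) atTop (𝓝 0) := by
        simpa [Function.comp_def] using (Real.continuous_sqrt.tendsto _).comp hut
      have := ((((hν2.mul hu1).sub_const 1).const_mul x).div hκ1 one_ne_zero).add
        ((h4.div h2 one_ne_zero).mul_const g)
      convert! this using 2
      norm_num
    refine h1.congr' ?_
    filter_upwards [hgood] with n ⟨hn, h0, _, hk, _⟩
    have hn' : (0 : ℝ) < n := by exact_mod_cast hn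
    have hs : √(n : ℝ) * σ n = √(u n * t n) := by
      simp only [hσ]
      rw [← Real.sqrt_mul hn'.le]
      congr 1
      simp only [hu]
      field_simp; ring
    have hxt : x = √(n : ℝ) * t n := by
      simp only [ht]
      have := Real.sqrt_pos.2 hn'
      field_simp
    have hk' : κ n = 1 - ν n * (u n * t n) := rfl
    have hu' : u n = 1 - t n := rfl
    simp only [hδ]
    rw [← hs, mul_add]
    nth_rw 1 [hxt]
    have e : √(n : ℝ) * t n * (ν n * u n - 1) / κ n = √(n : ℝ) * (u n / κ n - 1) := by
      rw [mul_assoc, mul_div_assoc]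
      congr 1
      rw [div_sub_one hk.ne']
      congr 1
      rw [hk', hu']; ring
    rw [e]; ring
  have hδ0 : ∀ g, Tendsto (fun n : ℕ => δ n g) atTop (𝓝 0) := by
    intro g
    have := (hδx g).mul hsqrt.inv_tendsto_atTop
    rw [mul_zero] at this
    refine this.congr' ?_
    filter_upwards [eventually_gt_atTop 0] with n hn
    have hn' : (0 : ℝ) < n := by exact_mod_cast hn
    have := Real.sqrt_pos.2 hn'
    simp only [Pi.inv_apply]
    field_simp
  set z : ℕ → ℝ → ℝ := fun n g => (1 + δ n g) * Real.exp ((1 - (1 + δ n g) ^ 2) / 2) with hz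
  have hzlim : ∀ g, Tendsto (fun n => z n g ^ (2 * n - j)) atTop
      (𝓝 (Real.exp (-x ^ 2) * Real.exp (-x ^ 2))) := by
    intro g
    have h1 := tendsto_mul_exp_pow (hδx g) (hδ0 g)
    have h2 : Tendsto (fun n => z n g) atTop (𝓝 1) := by
      have hc : Continuous fun d : ℝ => (1 + d) * Real.exp ((1 - (1 + d) ^ 2) / 2) := by fun_prop
      have := (hc.tendsto 0).comp (hδ0 g)
      simpa [Function.comp_def] using this
    refine (h1.mul (tendsto_pow_sub_of_tendsto_pow h2 h1 j)).congr' ?_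
    filter_upwards [eventually_ge_atTop j] with n hn
    rw [← pow_add]
    congr 1; omega
  have key := tendsto_integral_filter_of_dominated_convergence (μ := gaussianReal 0 1)
    (F := fun n g => z n g ^ (2 * n - j)) (l := atTop) (fun _ => 1)
    (Eventually.of_forall fun n => by
      refine Continuous.aestronglyMeasurable ?_
      simp only [hz, hδ]; fun_prop)
    (Eventually.of_forall fun n => Eventually.of_forall fun g => by
      rw [norm_pow, Real.norm_eq_abs]
      exact pow_le_one₀ (abs_nonneg _) (abs_mul_exp_le_one _))
    (integrable_const _)
    (Eventually.of_forall hzlim)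
  rw [integral_const, probReal_univ, one_smul] at key
  have hfin := hfac.mul key
  have e0 : Real.exp (-x ^ 2) * (Real.exp (-x ^ 2) * Real.exp (-x ^ 2))
      = Real.exp (-(3 * x ^ 2)) := by
    rw [← Real.exp_add, ← Real.exp_add]; congr 1; ring
  rw [e0] at hfin
  refine hfin.congr' ?_
  filter_upwards [hgood] with n ⟨hn, h0, h1, hk, _⟩
  have hn' : (0 : ℝ) < n := by exact_mod_cast hn
  change _ = gaussMoment n (2 * n - j) (u n)
  rw [gaussMoment_eq_integral n _ h0 h1]
  have hκσ : 1 - 2 * (((2 * n - j : ℕ) : ℝ) / 2) * σ n ^ 2 = κ n := by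
    have hσ2 : σ n ^ 2 = u n * (1 - u n) / n :=
      Real.sq_sqrt (div_nonneg (mul_nonneg h0 (by linarith)) (Nat.cast_nonneg n))
    rw [hσ2]
    simp only [hκ, hν, hu]
    field_simp; ring
  have htilt := integral_exp_sq_mul_gaussianReal
    (fun z => (z * Real.exp ((1 - z ^ 2) / 2)) ^ (2 * n - j)) (u n) (σ n)
    (((2 * n - j : ℕ) : ℝ) / 2) (by rw [hκσ]; exact hk)
  rw [hκσ] at htilt
  have hl : ∀ g, Real.exp (((2 * n - j : ℕ) : ℝ) / 2 * ((u n + σ n * g) ^ 2 - 1))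
      * ((u n + σ n * g) * Real.exp ((1 - (u n + σ n * g) ^ 2) / 2)) ^ (2 * n - j)
      = (u n + σ n * g) ^ (2 * n - j) := by
    intro g
    rw [mul_pow, ← Real.exp_nat_mul, mul_comm, mul_assoc, ← Real.exp_add]
    have : ((2 * n - j : ℕ) : ℝ) * ((1 - (u n + σ n * g) ^ 2) / 2)
      + ((2 * n - j : ℕ) : ℝ) / 2 * ((u n + σ n * g) ^ 2 - 1) = 0 := by ring
    rw [this, Real.exp_zero, mul_one]
  simp only [hl] at htilt
  rw [htilt]
  congr 1
  refine integral_congr_ae (Eventually.of_forall fun g => ?_)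
  simp only [hz, hδ]
  rw [show 1 + (u n / κ n - 1 + σ n / √(κ n) * g) = u n / κ n + σ n / √(κ n) * g by ring]

/-! ### Integrals over the tail of a distribution function -/

/-- The properties of a distribution function `F` on its `q`-tail `[a, ∞)` that the asymptotic
analysis uses: `F` is twice differentiable there with integrable second derivative, and its density
is of the exact order `D (1 - F) ^ (γ + 1)` at the right endpoint, and at most `M` times that order
throughout. -/
structure RegularTail (F : ℝ → ℝ) (q a γ D M : ℝ) : Prop where
  qTail_eq : qTail F q = Set.Ici a
  apply_left : F a = q
  q_pos : 0 < q
  q_lt_one : q < 1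
  neg_one_lt : -1 < γ
  mono : Monotone F
  le_one : ∀ y, F y ≤ 1
  hasDerivAt : ∀ y, a ≤ y → HasDerivAt F (deriv F y) y
  hasDerivAt_deriv : ∀ y, a ≤ y → HasDerivAt (deriv F) (deriv (deriv F) y) y
  tendsto_atTop : Tendsto F atTop (𝓝 1)
  deriv_le : ∀ y, a ≤ y → deriv F y ≤ M * (1 - F y) ^ (γ + 1)
  tail : HasTailDensity F γ D
  integrable_deriv_deriv : IntegrableOn (deriv (deriv F)) (Set.Ici a)

/-- A monotone function takes the value `F y` nowhere else if its derivative at `y` is nonzero: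
otherwise it would be constant on one side of `y`. -/
theorem eq_of_apply_eq_of_deriv_ne_zero {F : ℝ → ℝ} (hF : Monotone F) {y y' : ℝ}
    (hd : deriv F y ≠ 0) (h : F y' = F y) : y' = y := by
  have hdiff : HasDerivAt F (deriv F y) y :=
    (not_imp_comm.1 deriv_zero_of_not_differentiableAt hd).hasDerivAt
  by_contra hne
  refine hd ?_
  rcases lt_or_gt_of_ne hne with hlt | hlt
  · have h1 : HasDerivWithinAt F 0 (Set.Iio y) y := by
      refine (hasDerivWithinAt_const y (Set.Iio y) (F y)).congr_of_eventuallyEq ?_ rfl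
      filter_upwards [Ioo_mem_nhdsLT hlt] with z hz
      exact le_antisymm (hF hz.2.le) (h ▸ hF hz.1.le)
    exact (uniqueDiffWithinAt_Iio y).eq_deriv _ hdiff.hasDerivWithinAt h1
  · have h1 : HasDerivWithinAt F 0 (Set.Ioi y) y := by
      refine (hasDerivWithinAt_const y (Set.Ioi y) (F y)).congr_of_eventuallyEq ?_ rfl
      filter_upwards [Ioo_mem_nhdsGT hlt] with z hz
      exact le_antisymm (h ▸ hF hz.2.le) (hF hz.1.le)
    exact (uniqueDiffWithinAt_Ioi y).eq_deriv _ hdiff.hasDerivWithinAt h1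

namespace RegularTail

variable {F : ℝ → ℝ} {q a γ D M : ℝ}

theorem mem_Icc (h : RegularTail F q a γ D M) {y : ℝ} (hy : a ≤ y) : F y ∈ Set.Icc q 1 :=
  ⟨h.apply_left ▸ h.mono hy, h.le_one y⟩

theorem deriv_nonneg (h : RegularTail F q a γ D M) (y : ℝ) : 0 ≤ deriv F y :=
  h.mono.deriv_nonneg

theorem deriv_eq_zero (h : RegularTail F q a γ D M) {y : ℝ} (hy : F y = 1) : deriv F y = 0 :=
  IsLocalMax.deriv_eq_zero (Eventually.of_forall fun z => hy ▸ h.le_one z)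

theorem nonneg_const (h : RegularTail F q a γ D M) : 0 ≤ M := by
  have h1 := (h.deriv_nonneg a).trans (h.deriv_le a le_rfl)
  rw [h.apply_left] at h1
  exact nonneg_of_mul_nonneg_left h1 (Real.rpow_pos_of_pos (by linarith [h.q_lt_one]) _)

theorem deriv_le_const (h : RegularTail F q a γ D M) {y : ℝ} (hy : a ≤ y) : deriv F y ≤ M := by
  refine (h.deriv_le y hy).trans (mul_le_of_le_one_right h.nonneg_const ?_)
  have := h.mem_Icc hy
  exact Real.rpow_le_one (by linarith [this.2]) (by linarith [this.1, h.q_pos])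
    (by linarith [h.neg_one_lt])

theorem tendsto_deriv (h : RegularTail F q a γ D M) : Tendsto (deriv F) atTop (𝓝 0) := by
  have hg : 0 < γ + 1 := by linarith [h.neg_one_lt]
  have h1 : Tendsto (fun y => M * (1 - F y) ^ (γ + 1)) atTop (𝓝 0) := by
    have h2 := (h.tendsto_atTop.const_sub 1).rpow_const (p := γ + 1) (Or.inr hg.le)
    rw [sub_self, Real.zero_rpow hg.ne'] at h2
    simpa using h2.const_mul M
  refine tendsto_of_tendsto_of_tendsto_of_le_of_le' tendsto_const_nhds h1
    (Eventually.of_forall h.deriv_nonneg) ?_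
  filter_upwards [eventually_ge_atTop a] with y hy using h.deriv_le y hy

theorem integrable_deriv (h : RegularTail F q a γ D M) : IntegrableOn (deriv F) (Set.Ici a) := by
  rw [integrableOn_Ici_iff_integrableOn_Ioi]
  exact integrableOn_Ioi_deriv_of_nonneg' h.hasDerivAt (fun y _ => h.deriv_nonneg y)
    h.tendsto_atTop

theorem exists_bound_comp (h : RegularTail F q a γ D M) {ψ : ℝ → ℝ} (hψ : Continuous ψ) :
    ∃ B, ∀ y, a ≤ y → |ψ (F y)| ≤ B := by
  obtain ⟨B, hB⟩ := isCompact_Icc.exists_bound_of_continuousOn (s := Set.Icc q 1) hψ.continuousOn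
  exact ⟨B, fun y hy => hB _ (h.mem_Icc hy)⟩

theorem integrableOn_mul_comp (h : RegularTail F q a γ D M) {g : ℝ → ℝ}
    (hg : IntegrableOn g (Set.Ici a)) {ψ : ℝ → ℝ} (hψ : Continuous ψ) :
    IntegrableOn (fun y => g y * ψ (F y)) (Set.Ici a) := by
  obtain ⟨B, hB⟩ := h.exists_bound_comp hψ
  refine (Integrable.bdd_mul (c := B) hg
    (hψ.measurable.comp h.mono.measurable).aestronglyMeasurable ?_).congr ?_
  · filter_upwards [ae_restrict_mem measurableSet_Ici] with y hy using hB y hy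
  · exact Eventually.of_forall fun y => mul_comm _ _

theorem integrableOn_deriv_sq (h : RegularTail F q a γ D M) :
    IntegrableOn (fun y => deriv F y ^ 2) (Set.Ici a) := by
  refine (Integrable.bdd_mul (c := M) h.integrable_deriv
    (measurable_deriv F).aestronglyMeasurable ?_).congr ?_
  · filter_upwards [ae_restrict_mem measurableSet_Ici] with y hy
    rw [Real.norm_eq_abs, abs_of_nonneg (h.deriv_nonneg y)]
    exact h.deriv_le_const hy
  · exact Eventually.of_forall fun y => (sq _).symm

/-- Integration by parts on the tail: the boundary term at the right endpoint vanishes because the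
density does. -/
theorem integral_deriv_deriv_mul (h : RegularTail F q a γ D M) {φ φ' : ℝ → ℝ}
    (hφ : ∀ u, HasDerivAt φ (φ' u) u) (hφ' : Continuous φ') :
    ∫ y in Set.Ici a, deriv (deriv F) y * φ (F y)
      = -(deriv F a * φ q) - ∫ y in Set.Ici a, deriv F y ^ 2 * φ' (F y) := by
  have hφc : Continuous φ := continuous_iff_continuousAt.2 fun u => (hφ u).continuousAt
  have i1 := h.integrableOn_mul_comp h.integrable_deriv_deriv hφc
  have i2 := h.integrableOn_mul_comp h.integrableOn_deriv_sq hφ'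
  have hd : ∀ y ∈ Set.Ici a, HasDerivAt (fun y => deriv F y * φ (F y))
      (deriv (deriv F) y * φ (F y) + deriv F y ^ 2 * φ' (F y)) y := by
    intro y hy
    refine ((h.hasDerivAt_deriv y hy).mul ((hφ (F y)).comp y (h.hasDerivAt y hy))).congr_deriv ?_
    simp only [Function.comp]
    ring
  have hlim : Tendsto (fun y => deriv F y * φ (F y)) atTop (𝓝 0) := by
    have := h.tendsto_deriv.mul ((hφc.tendsto 1).comp h.tendsto_atTop)
    simpa using this
  have key := integral_Ioi_of_hasDerivAt_of_tendsto' hd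
    ((i1.add i2).mono_set Set.Ioi_subset_Ici_self) hlim
  rw [← integral_Ici_eq_integral_Ioi, integral_add i1 i2, h.apply_left] at key
  linarith

/-- The density as a function of the level `u = F y`, for `u` between `q` and `1`. -/
theorem exists_density_quantile (h : RegularTail F q a γ D M) : ∃ G : ℝ → ℝ,
    AEMeasurable G (volume.restrict (Set.Ioo q 1)) ∧
    (∀ u ∈ Set.Ioo q 1, 0 ≤ G u ∧ G u ≤ M * (1 - u) ^ (γ + 1)) ∧
    Tendsto (fun u => G u / (1 - u) ^ (γ + 1)) (𝓝[<] 1) (𝓝 D) ∧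
    ∀ ψ : ℝ → ℝ, ∫ y in Set.Ici a, deriv F y ^ 2 * ψ (F y) = ∫ u in Set.Ioo q 1, G u * ψ u := by
  have hex : ∀ u ∈ Set.Ioo q 1, ∃ y, a ≤ y ∧ F y = u := by
    intro u hu
    obtain ⟨b, hb, hab⟩ := ((h.tendsto_atTop.eventually_const_lt hu.2).and
      (eventually_ge_atTop a)).exists
    have hc : ContinuousOn F (Set.Icc a b) := fun y hy =>
      (h.hasDerivAt y hy.1).continuousAt.continuousWithinAt
    obtain ⟨y, hy, hyu⟩ := intermediate_value_Icc hab hc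
      (show u ∈ Set.Icc (F a) (F b) from ⟨h.apply_left ▸ hu.1.le, hb.le⟩)
    exact ⟨y, hy.1, hyu⟩
  choose! Y hYa hY using hex
  refine ⟨fun u => deriv F (Y u), ?_, ?_, ?_, ?_⟩
  · -- the chosen quantile function `Y` is monotone
    refine (measurable_deriv F).comp_aemeasurable
      (aemeasurable_restrict_of_monotoneOn measurableSet_Ioo fun u hu v hv huv => ?_)
    rcases huv.eq_or_lt with rfl | hlt
    · exact le_rfl
    · by_contra hcon
      have := h.mono (not_le.1 hcon).le
      rw [hY u hu, hY v hv] at this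
      linarith
  · intro u hu
    refine ⟨h.deriv_nonneg _, ?_⟩
    have := h.deriv_le (Y u) (hYa u hu)
    rwa [hY u hu] at this
  · have hmem : Set.Ioo q 1 ∈ 𝓝[<] (1 : ℝ) := Ioo_mem_nhdsLT h.q_lt_one
    have hYt : Tendsto Y (𝓝[<] 1) (comap F (𝓝[<] 1)) := by
      rw [tendsto_comap_iff]
      refine tendsto_id.congr' ?_
      filter_upwards [hmem] with u hu using (hY u hu).symm
    refine (Tendsto.comp h.tail hYt).congr' ?_
    filter_upwards [hmem] with u hu
    simp only [Function.comp, hY u hu]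
  · intro ψ
    have hcv := integral_image_eq_integral_deriv_smul_of_monotoneOn (measurableSet_Ici (a := a))
      (fun y hy => (h.hasDerivAt y hy).hasDerivWithinAt) (h.mono.monotoneOn _)
      (fun u => deriv F (Y u) * ψ u)
    have hset : F '' Set.Ici a =ᵐ[volume] Set.Ioo q 1 := by
      have h1 : Set.Ioo q 1 ⊆ F '' Set.Ici a := fun u hu => ⟨Y u, hYa u hu, hY u hu⟩
      have h2 : F '' Set.Ici a ⊆ Set.Icc q 1 := by
        rintro _ ⟨y, hy, rfl⟩
        exact h.mem_Icc hy
      exact (h2.eventuallyLE.trans Ioo_ae_eq_Icc.symm.le).antisymm h1.eventuallyLE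
    rw [setIntegral_congr_set hset] at hcv
    rw [hcv, integral_Ici_eq_integral_Ioi, integral_Ici_eq_integral_Ioi]
    refine setIntegral_congr_fun measurableSet_Ioi fun y hy => ?_
    simp only [smul_eq_mul]
    -- where the density does not vanish, `y` is the only point of its level
    rcases eq_or_ne (deriv F y) 0 with h0 | h0
    · simp [h0]
    · have hmem := h.mem_Icc (le_of_lt hy)
      have h1 : F y ≠ 1 := fun hy1 => h0 (h.deriv_eq_zero hy1)
      have h2 : q ≠ F y := fun hq => by
        have := eq_of_apply_eq_of_deriv_ne_zero h.mono h0 (h.apply_left.trans hq)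
        exact absurd hy (by simp [this])
      have hu : F y ∈ Set.Ioo q 1 := ⟨lt_of_le_of_ne hmem.1 h2, lt_of_le_of_ne hmem.2 h1⟩
      rw [eq_of_apply_eq_of_deriv_ne_zero h.mono h0 (hY _ hu)]
      ring

/-- Dominated convergence on the tail at the scale `1 - F y ∼ s n * x`. With `u = F y` the integral
becomes that of `G u * ψ n u` for the density `G` at level `u`, and `G (1 - s n * x)` is about
`D (s n * x) ^ (γ + 1)`. -/
theorem tendsto_integral_sq_mul (h : RegularTail F q a γ D M) {ψ : ℕ → ℝ → ℝ}
    (hψ : ∀ n, Continuous (ψ n)) {s : ℕ → ℝ} (hs : ∀ᶠ n in atTop, 0 < s n)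
    (hs0 : Tendsto s atTop (𝓝 0)) {Ψ H : ℝ → ℝ}
    (hbound : ∀ᶠ n in atTop, ∀ x, 0 < x → s n * x ≤ 1 → |ψ n (1 - s n * x)| ≤ H x)
    (hH : IntegrableOn (fun x => x ^ (γ + 1) * H x) (Set.Ioi 0))
    (hlim : ∀ x, 0 < x → Tendsto (fun n => ψ n (1 - s n * x)) atTop (𝓝 (Ψ x))) :
    Tendsto (fun n => s n ^ (-(γ + 2)) * ∫ y in Set.Ici a, deriv F y ^ 2 * ψ n (F y)) atTop
      (𝓝 (D * ∫ x in Set.Ioi 0, x ^ (γ + 1) * Ψ x)) := by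
  obtain ⟨G, hGm, hGb, hGD, hGint⟩ := h.exists_density_quantile
  simp only [hGint]
  set Φ : ℕ → ℝ → ℝ := fun n => (Set.Ioo q 1).indicator (fun u => G u * ψ n u) with hΦ
  have hint : ∀ n, 0 < s n → s n ^ (-(γ + 2)) * ∫ u in Set.Ioo q 1, G u * ψ n u
      = ∫ x, s n ^ (-(γ + 1)) * Φ n (1 - s n * x) := by
    intro n hn
    rw [← integral_indicator measurableSet_Ioo, integral_const_mul,
      Measure.integral_comp_mul_left (fun v => Φ n (1 - v)) (s n), integral_sub_left_eq_self,
      abs_of_pos (inv_pos.2 hn), smul_eq_mul, ← mul_assoc, ← Real.rpow_neg_one (s n),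
      ← Real.rpow_add hn]
    congr 2; ring
  have hΦm : ∀ n, AEStronglyMeasurable (Φ n) volume := fun n =>
    ((aemeasurable_indicator_iff measurableSet_Ioo).2
      (hGm.mul (hψ n).aemeasurable)).aestronglyMeasurable
  rw [← integral_const_mul, ← integral_indicator measurableSet_Ioi]
  have hterm : ∀ n x, 0 < s n → 0 < x → s n * x < 1 - q → s n ^ (-(γ + 1)) * Φ n (1 - s n * x)
      = x ^ (γ + 1) * (G (1 - s n * x) / (1 - (1 - s n * x)) ^ (γ + 1)) * ψ n (1 - s n * x) := by
    intro n x hn hx hlt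
    have hsx : 0 < s n * x := mul_pos hn hx
    have hu : 1 - s n * x ∈ Set.Ioo q 1 := ⟨by linarith, by linarith⟩
    simp only [hΦ, Set.indicator_of_mem hu]
    rw [sub_sub_cancel, Real.mul_rpow hn.le hx.le, Real.rpow_neg hn.le]
    have := Real.rpow_pos_of_pos hn (γ + 1)
    have := Real.rpow_pos_of_pos hx (γ + 1)
    field_simp
  have hzero : ∀ n x, 0 < s n → ¬(0 < x ∧ s n * x < 1 - q) → Φ n (1 - s n * x) = 0 := by
    intro n x hn hx
    refine Set.indicator_of_notMem (fun hu => hx ⟨?_, by linarith [hu.1]⟩) _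
    have : 0 < s n * x := by linarith [hu.2]
    exact pos_of_mul_pos_right this hn.le
  have key := tendsto_integral_filter_of_dominated_convergence (μ := volume) (l := atTop)
    (F := fun n x => s n ^ (-(γ + 1)) * Φ n (1 - s n * x))
    (f := (Set.Ioi 0).indicator fun x => D * (x ^ (γ + 1) * Ψ x))
    ((Set.Ioi 0).indicator fun x => M * ‖x ^ (γ + 1) * H x‖) ?_ ?_ ?_ ?_
  · refine key.congr' ?_
    filter_upwards [hs] with n hn using (hint n hn).symm
  · filter_upwards [hs] with n hn
    refine AEStronglyMeasurable.const_mul ?_ _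
    have q1 := Measure.quasiMeasurePreserving_smul (volume : Measure ℝ) hn.ne'
    have q2 := (Measure.measurePreserving_sub_left (volume : Measure ℝ) 1).quasiMeasurePreserving
    exact (hΦm n).comp_quasiMeasurePreserving (q2.comp q1)
  · filter_upwards [hs, hbound] with n hn hb
    refine Eventually.of_forall fun x => ?_
    by_cases hx : 0 < x ∧ s n * x < 1 - q
    · rw [hterm n x hn hx.1 hx.2, Set.indicator_of_mem (Set.mem_Ioi.2 hx.1), Real.norm_eq_abs,
        abs_mul, abs_mul]
      have hsx : 0 < s n * x := mul_pos hn hx.1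
      have hu : 1 - s n * x ∈ Set.Ioo q 1 := ⟨by linarith [hx.2], by linarith⟩
      have hp : 0 < (1 - (1 - s n * x)) ^ (γ + 1) := Real.rpow_pos_of_pos (by linarith) _
      have hxp : 0 < x ^ (γ + 1) := Real.rpow_pos_of_pos hx.1 _
      rw [abs_of_pos hxp, abs_of_nonneg (div_nonneg (hGb _ hu).1 hp.le)]
      have h1 : G (1 - s n * x) / (1 - (1 - s n * x)) ^ (γ + 1) ≤ M :=
        (div_le_iff₀ hp).2 (hGb _ hu).2
      have h2 := hb x hx.1 (by linarith [h.q_pos])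
      rw [Real.norm_eq_abs, abs_mul, abs_of_pos hxp]
      calc _ ≤ x ^ (γ + 1) * M * |H x| := by
            refine mul_le_mul (mul_le_mul_of_nonneg_left h1 hxp.le) (h2.trans (le_abs_self _))
              (abs_nonneg _) (mul_nonneg hxp.le h.nonneg_const)
        _ = _ := by ring
    · rw [hzero n x hn hx, mul_zero, norm_zero]
      exact Set.indicator_nonneg (fun x _ => mul_nonneg h.nonneg_const (norm_nonneg _)) x
  · rw [integrable_indicator_iff measurableSet_Ioi]
    exact hH.norm.const_mul M
  · refine Eventually.of_forall fun x => ?_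
    by_cases hx : 0 < x
    · rw [Set.indicator_of_mem (Set.mem_Ioi.2 hx)]
      have hsx : Tendsto (fun n => s n * x) atTop (𝓝 0) := by simpa using hs0.mul_const x
      have hu : Tendsto (fun n => 1 - s n * x) atTop (𝓝[<] 1) := by
        refine tendsto_nhdsWithin_iff.2 ⟨by simpa using hsx.const_sub 1, ?_⟩
        filter_upwards [hs] with n hn
        have : 0 < s n * x := mul_pos hn hx
        simp [this]
      have h1 := ((hGD.comp hu).const_mul (x ^ (γ + 1))).mul (hlim x hx)
      rw [show x ^ (γ + 1) * D * Ψ x = D * (x ^ (γ + 1) * Ψ x) by ring] at h1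
      refine h1.congr' ?_
      filter_upwards [hs, hsx.eventually_lt_const (sub_pos.2 h.q_lt_one)] with n hn hlt
      rw [hterm n x hn hx hlt]
      rfl
    · rw [Set.indicator_of_notMem (by simpa using hx)]
      refine tendsto_const_nhds.congr' ?_
      filter_upwards [hs] with n hn
      rw [hzero n x hn (fun hc => hx hc.1), mul_zero]

end RegularTail

/-- The left end `a` of the tail is the `q`-quantile, which `F` attains because it is continuous
there. The bound on the density follows from the tail condition at levels close to `1`, and from
continuity on the remaining compact interval. -/
theorem exists_regularTail {P : Measure ℝ} [IsProbabilityMeasure P] {γ D q : ℝ}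
    (hC2 : ∀ y : ℝ, 0 < cdf P y → ContDiffAt ℝ 2 (cdf P) y) (hγ : -1 < γ)
    (htail : HasTailDensity (cdf P) γ D) (hq0 : 0 < q) (hq1 : q < 1)
    (hint : IntegrableOn (deriv (deriv (cdf P))) (qTail (cdf P) q)) :
    ∃ a M, RegularTail (cdf P) q a γ D M := by
  set F : ℝ → ℝ := ⇑(cdf P) with hF
  have hmono : Monotone F := monotone_cdf P
  have hle : ∀ y, F y ≤ 1 := cdf_le_one P
  have htop : Tendsto F atTop (𝓝 1) := tendsto_cdf_atTop P
  have hbot : Tendsto F atBot (𝓝 0) := tendsto_cdf_atBot P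
  have hne : (qTail F q).Nonempty := (htop.eventually_const_le hq1).exists
  have hbdd : BddBelow (qTail F q) := by
    obtain ⟨b, hb⟩ := (hbot.eventually_lt_const hq0).exists
    refine ⟨b, fun y hy => ?_⟩
    by_contra hcon
    have hy' : q ≤ F y := hy
    exact absurd (hmono (not_le.1 hcon).le) (by linarith)
  set a := sInf (qTail F q) with ha
  have hgt : ∀ y, a < y → q ≤ F y := by
    intro y hy
    obtain ⟨z, hz, hzy⟩ := exists_lt_of_csInf_lt hne hy
    exact le_trans hz (hmono hzy.le)
  have hlt : ∀ y, y < a → F y < q := by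
    intro y hy
    by_contra hcon
    exact absurd (csInf_le hbdd (not_lt.1 hcon : y ∈ qTail F q)) (not_le.2 hy)
  have hqa : q ≤ F a := by
    have hrc : Tendsto F (𝓝[>] a) (𝓝 (F a)) :=
      ((cdf P).right_continuous a).mono_left (nhdsWithin_mono a Set.Ioi_subset_Ici_self)
    refine ge_of_tendsto hrc ?_
    filter_upwards [self_mem_nhdsWithin] with y hy using hgt y hy
  have hset : qTail F q = Set.Ici a := by
    ext y
    constructor
    · intro hy; exact csInf_le hbdd hy
    · intro hy
      rcases (show a ≤ y from hy).eq_or_lt with rfl | hy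
      · exact hqa
      · exact hgt y hy
  have hpos : ∀ y, a ≤ y → 0 < F y := fun y hy => hq0.trans_le (hqa.trans (hmono hy))
  have hFa : F a = q := by
    refine le_antisymm ?_ hqa
    have hc : Tendsto F (𝓝[<] a) (𝓝 (F a)) :=
      (hC2 a (hpos a le_rfl)).continuousAt.tendsto.mono_left nhdsWithin_le_nhds
    refine le_of_tendsto hc ?_
    filter_upwards [self_mem_nhdsWithin] with y hy using (hlt y hy).le
  have hd1 : ∀ y, a ≤ y → HasDerivAt F (deriv F y) y := fun y hy =>
    ((hC2 y (hpos y hy)).differentiableAt (by norm_num)).hasDerivAt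
  have hd2 : ∀ y, a ≤ y → HasDerivAt (deriv F) (deriv (deriv F) y) y := fun y hy =>
    (((hC2 y (hpos y hy)).derivWithin (m := 1) (by norm_num)).differentiableAt
      (by norm_num)).hasDerivAt
  have hnn : ∀ y, 0 ≤ deriv F y := fun y => hmono.deriv_nonneg
  have hg1 : 0 < γ + 1 := by linarith
  obtain ⟨l, hl1, hl⟩ : ∃ l < 1, ∀ y, l < F y → F y < 1 →
      deriv F y / (1 - F y) ^ (γ + 1) < D + 1 := by
    have h1 : ∀ᶠ y in comap F (𝓝[<] 1), deriv F y / (1 - F y) ^ (γ + 1) < D + 1 :=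
      htail.eventually_lt_const (by linarith)
    obtain ⟨s, hs, hsub⟩ := mem_comap.1 h1
    obtain ⟨l, hl1, hl⟩ := mem_nhdsLT_iff_exists_Ioo_subset.1 hs
    exact ⟨l, hl1, fun y hy1 hy2 => hsub (hl ⟨hy1, hy2⟩)⟩
  obtain ⟨b, hb⟩ := (htop.eventually_const_lt hl1).exists
  obtain ⟨B, hB⟩ := isCompact_Icc.exists_bound_of_continuousOn (s := Set.Icc a b)
    (f := deriv F) fun y hy => (hd2 y hy.1).continuousAt.continuousWithinAt
  refine ⟨a, max (D + 1) (|B| / (1 - l) ^ (γ + 1)), hset, hFa, hq0, hq1, hγ, hmono, hle, hd1, hd2,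
    htop, fun y hy => ?_, htail, hset ▸ hint⟩
  rcases (hle y).eq_or_lt with h1 | h1
  · -- at and beyond the right endpoint the density vanishes
    have : deriv F y = 0 :=
      IsLocalMax.deriv_eq_zero (Eventually.of_forall fun z => h1 ▸ hle z)
    rw [this, h1, sub_self, Real.zero_rpow hg1.ne', mul_zero]
  · have hp : 0 < (1 - F y) ^ (γ + 1) := Real.rpow_pos_of_pos (by linarith) _
    rw [← div_le_iff₀ hp]
    by_cases h2 : l < F y
    · exact (hl y h2 h1).le.trans (le_max_left _ _)
    · refine le_trans ?_ (le_max_right _ _)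
      have hyb : y ≤ b := by
        by_contra hcon
        exact h2 (hb.trans_le (hmono (not_le.1 hcon).le))
      have h3 := hB y ⟨hy, hyb⟩
      rw [Real.norm_eq_abs, abs_of_nonneg (hnn y)] at h3
      have h4 : 0 < (1 - l) ^ (γ + 1) := Real.rpow_pos_of_pos (by linarith) _
      refine div_le_div₀ (abs_nonneg _) (h3.trans (le_abs_self _)) h4 ?_
      exact Real.rpow_le_rpow (by linarith) (by linarith [not_lt.1 h2]) hg1.le

/-! ### Coefficients of the second order expansion for a centred kernel -/

/-- The derivative of `gaussMoment n N`. -/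
def gaussMomentDeriv (n N : ℕ) (u : ℝ) : ℝ :=
  N * gaussMoment n (N - 1) u
    + (1 - 2 * u) * ((N : ℝ) * (N - 1) / (2 * n)) * gaussMoment n (N - 2) u

/-- The coefficient of `F''` in `E_{2,N}`, for a centred kernel with `s = μ_{K²,2}` and
`m = μ_{K,2}`, as a function of `u = F y`. -/
def curvatureCoeff (s m : ℝ) (n N : ℕ) (u : ℝ) : ℝ :=
  (N : ℝ) * (N - 1) / (2 * n) * gaussMoment n (N - 2) u * (s / 2 - u * m)
    + N / 2 * m * gaussMoment n (N - 1) u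

/-- The derivative of `curvatureCoeff`. -/
def curvatureCoeffDeriv (s m : ℝ) (n N : ℕ) (u : ℝ) : ℝ :=
  (N : ℝ) * (N - 1) / (2 * n)
      * (gaussMomentDeriv n (N - 2) u * (s / 2 - u * m) - m * gaussMoment n (N - 2) u)
    + N / 2 * m * gaussMomentDeriv n (N - 1) u

/-- The coefficient of `F' ^ 2 μ_{K²,1} ^ 2` in `E_{2,N}`, for a centred kernel, as a function of
`u = F y`. -/
def slopeCoeff (n N : ℕ) (u : ℝ) : ℝ :=
  (N : ℝ) * (N - 1) * (N - 2) * (N - 3) / (8 * n ^ 2) * gaussMoment n (N - 4) u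

theorem continuous_gaussMomentDeriv (n N : ℕ) : Continuous (gaussMomentDeriv n N) := by
  have h1 := continuous_gaussMoment n (N - 1)
  have h2 := continuous_gaussMoment n (N - 2)
  unfold gaussMomentDeriv; fun_prop

theorem continuous_curvatureCoeff (s m : ℝ) (n N : ℕ) : Continuous (curvatureCoeff s m n N) := by
  have h1 := continuous_gaussMoment n (N - 1)
  have h2 := continuous_gaussMoment n (N - 2)
  unfold curvatureCoeff; fun_prop

theorem continuous_curvatureCoeffDeriv (s m : ℝ) (n N : ℕ) :
    Continuous (curvatureCoeffDeriv s m n N) := by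
  have h1 := continuous_gaussMomentDeriv n (N - 1)
  have h2 := continuous_gaussMomentDeriv n (N - 2)
  have h3 := continuous_gaussMoment n (N - 2)
  unfold curvatureCoeffDeriv; fun_prop

theorem continuous_slopeCoeff (n N : ℕ) : Continuous (slopeCoeff n N) := by
  have h1 := continuous_gaussMoment n (N - 4)
  unfold slopeCoeff; fun_prop

theorem hasDerivAt_curvatureCoeff (s m : ℝ) {n : ℕ} (hn : n ≠ 0) (N : ℕ) (u : ℝ) :
    HasDerivAt (curvatureCoeff s m n N) (curvatureCoeffDeriv s m n N u) u := by
  have h1 : HasDerivAt (gaussMoment n (N - 1)) (gaussMomentDeriv n (N - 1) u) u :=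
    hasDerivAt_gaussMoment hn _ u
  have h2 : HasDerivAt (gaussMoment n (N - 2)) (gaussMomentDeriv n (N - 2) u) u :=
    hasDerivAt_gaussMoment hn _ u
  have h3 : HasDerivAt (fun u : ℝ => s / 2 - u * m) (-m) u := by
    simpa using ((hasDerivAt_id u).mul_const m).const_sub (s / 2)
  refine (((h2.const_mul ((N : ℝ) * (N - 1) / (2 * n))).mul h3).add
    (h1.const_mul ((N : ℝ) / 2 * m))).congr_deriv ?_
  unfold curvatureCoeffDeriv
  ring

section Expansion

variable {F K : ℝ → ℝ}

theorem E1_eq (hK : mu K 1 = 0) {n : ℕ} (hn : n ≠ 0) (N : ℕ) (y : ℝ) :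
    E1 F K n N y
      = -(deriv F y * (muSq K 1 * ((N : ℝ) * (N - 1) / (2 * n) * gaussMoment n (N - 2) (F y)))) := by
  rw [E1, FY1, hK, ← Finset.sum_mul, sum_mul_gaussWeight hn, alpha, hK]
  ring

theorem E2a_eq (hK : mu K 1 = 0) {n : ℕ} (hn : n ≠ 0) (N : ℕ) (y : ℝ) :
    E2a F K n N y = deriv (deriv F) y * curvatureCoeff (muSq K 2) (mu K 2) n N (F y) := by
  rw [E2a, FY2beta, ← Finset.sum_mul, sum_mul_gaussWeight hn, beta, hK, FY0_eq, curvatureCoeff]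
  ring

theorem E2b_eq (hK : mu K 1 = 0) {n : ℕ} (hn : n ≠ 0) (N : ℕ) (y : ℝ) :
    E2b F K n N y = deriv F y ^ 2 * (muSq K 1 ^ 2 * slopeCoeff n N (F y)) := by
  rw [E2b, FY2alpha, ← Finset.sum_mul, sum_mul_mul_gaussWeight hn, alpha, hK, slopeCoeff]
  ring

/-- The coefficient of `F''` in `b_0 b_2`. -/
def biasCurvature (s m : ℝ) (n : ℕ) (u : ℝ) : ℝ :=
  (gaussMoment n n u - u ^ n) * curvatureCoeff s m n n u

/-- The derivative of `biasCurvature`. -/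
def biasCurvatureDeriv (s m : ℝ) (n : ℕ) (u : ℝ) : ℝ :=
  (gaussMomentDeriv n n u - n * u ^ (n - 1)) * curvatureCoeff s m n n u
    + (gaussMoment n n u - u ^ n) * curvatureCoeffDeriv s m n n u

/-- The coefficient of `F''` in `V_2`. -/
def varCurvature (s m : ℝ) (n : ℕ) (u : ℝ) : ℝ :=
  curvatureCoeff s m n (2 * n) u - 2 * gaussMoment n n u * curvatureCoeff s m n n u

/-- The derivative of `varCurvature`. -/
def varCurvatureDeriv (s m : ℝ) (n : ℕ) (u : ℝ) : ℝ :=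
  curvatureCoeffDeriv s m n (2 * n) u - 2 * (gaussMomentDeriv n n u * curvatureCoeff s m n n u
    + gaussMoment n n u * curvatureCoeffDeriv s m n n u)

/-- The coefficient of `F' ^ 2` in `b_0 b_2`, with `c = μ_{K²,1}`. -/
def biasSlope (c : ℝ) (n : ℕ) (u : ℝ) : ℝ :=
  (gaussMoment n n u - u ^ n) * (c ^ 2 * slopeCoeff n n u)

/-- The coefficient of `F' ^ 2` in `V_2`, with `c = μ_{K²,1}`. -/
def varSlope (c : ℝ) (n : ℕ) (u : ℝ) : ℝ :=
  c ^ 2 * (slopeCoeff n (2 * n) u - 2 * gaussMoment n n u * slopeCoeff n n u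
    - ((n : ℝ) * (n - 1) / (2 * n) * gaussMoment n (n - 2) u) ^ 2)

theorem b0_mul_b2_eq (hK : mu K 1 = 0) {n : ℕ} (hn : n ≠ 0) (y : ℝ) :
    b0 F n y * b2 F K n y
      = deriv (deriv F) y * biasCurvature (muSq K 2) (mu K 2) n (F y)
        + deriv F y ^ 2 * biasSlope (muSq K 1) n (F y) := by
  rw [b0, b2, E0, E2a_eq hK hn, E2b_eq hK hn, FY0_eq, biasCurvature, biasSlope]
  ring

theorem V2_eq (hK : mu K 1 = 0) {n : ℕ} (hn : n ≠ 0) (y : ℝ) :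
    V2 F K n y
      = deriv (deriv F) y * varCurvature (muSq K 2) (mu K 2) n (F y)
        + deriv F y ^ 2 * varSlope (muSq K 1) n (F y) := by
  rw [V2, V2a, V2b, E0, E1_eq hK hn, E2a_eq hK hn, E2a_eq hK hn, E2b_eq hK hn, E2b_eq hK hn,
    FY0_eq, varCurvature, varSlope]
  ring

end Expansion

theorem hasDerivAt_biasCurvature (s m : ℝ) {n : ℕ} (hn : n ≠ 0) (u : ℝ) :
    HasDerivAt (biasCurvature s m n) (biasCurvatureDeriv s m n u) u := by
  have h1 : HasDerivAt (gaussMoment n n) (gaussMomentDeriv n n u) u :=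
    hasDerivAt_gaussMoment hn _ u
  exact (h1.sub (hasDerivAt_pow n u)).mul (hasDerivAt_curvatureCoeff s m hn n u)

theorem hasDerivAt_varCurvature (s m : ℝ) {n : ℕ} (hn : n ≠ 0) (u : ℝ) :
    HasDerivAt (varCurvature s m n) (varCurvatureDeriv s m n u) u := by
  have h1 : HasDerivAt (gaussMoment n n) (gaussMomentDeriv n n u) u :=
    hasDerivAt_gaussMoment hn _ u
  refine ((hasDerivAt_curvatureCoeff s m hn (2 * n) u).sub
    ((h1.const_mul 2).mul (hasDerivAt_curvatureCoeff s m hn n u))).congr_deriv ?_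
  unfold varCurvatureDeriv
  ring

theorem continuous_biasCurvatureDeriv (s m : ℝ) (n : ℕ) :
    Continuous (biasCurvatureDeriv s m n) := by
  have h1 := continuous_gaussMoment n n
  have h2 := continuous_gaussMomentDeriv n n
  have h3 := continuous_curvatureCoeff s m n n
  have h4 := continuous_curvatureCoeffDeriv s m n n
  unfold biasCurvatureDeriv; fun_prop

theorem continuous_varCurvatureDeriv (s m : ℝ) (n : ℕ) :
    Continuous (varCurvatureDeriv s m n) := by
  have h1 := continuous_gaussMoment n n
  have h2 := continuous_gaussMomentDeriv n n
  have h3 := continuous_curvatureCoeff s m n n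
  have h4 := continuous_curvatureCoeffDeriv s m n n
  have h5 := continuous_curvatureCoeffDeriv s m n (2 * n)
  unfold varCurvatureDeriv; fun_prop

theorem continuous_biasSlope (c : ℝ) (n : ℕ) : Continuous (biasSlope c n) := by
  have h1 := continuous_gaussMoment n n
  have h2 := continuous_slopeCoeff n n
  unfold biasSlope; fun_prop

theorem continuous_varSlope (c : ℝ) (n : ℕ) : Continuous (varSlope c n) := by
  have h1 := continuous_gaussMoment n n
  have h2 := continuous_slopeCoeff n n
  have h3 := continuous_slopeCoeff n (2 * n)
  have h4 := continuous_gaussMoment n (n - 2)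
  unfold varSlope; fun_prop

/-! ### Dominated limits at a given scale -/

/-- On the domains `0 < x ≤ 1 / s n`, the functions `X n` are dominated by a multiple of `w`, and
they converge pointwise to `L`. -/
def DominatedLimit (s : ℕ → ℝ) (w : ℝ → ℝ) (X : ℕ → ℝ → ℝ) (L : ℝ → ℝ) : Prop :=
  (∃ C, ∀ᶠ n in atTop, ∀ x, 0 < x → s n * x ≤ 1 → |X n x| ≤ C * w x) ∧
    ∀ x, 0 < x → Tendsto (fun n => X n x) atTop (𝓝 (L x))

namespace DominatedLimit

variable {s : ℕ → ℝ} {w : ℝ → ℝ} {X Y : ℕ → ℝ → ℝ} {L L' : ℝ → ℝ}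

theorem add (hX : DominatedLimit s w X L) (hY : DominatedLimit s w Y L') :
    DominatedLimit s w (fun n x => X n x + Y n x) (fun x => L x + L' x) := by
  obtain ⟨⟨C, hC⟩, hL⟩ := hX
  obtain ⟨⟨C', hC'⟩, hL'⟩ := hY
  refine ⟨⟨C + C', ?_⟩, fun x hx => (hL x hx).add (hL' x hx)⟩
  filter_upwards [hC, hC'] with n h h' x hx hsx
  rw [add_mul]
  exact (abs_add_le _ _).trans (add_le_add (h x hx hsx) (h' x hx hsx))

theorem mul (hX : DominatedLimit s (fun _ => 1) X L) (hY : DominatedLimit s w Y L') :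
    DominatedLimit s w (fun n x => X n x * Y n x) (fun x => L x * L' x) := by
  obtain ⟨⟨C, hC⟩, hL⟩ := hX
  obtain ⟨⟨C', hC'⟩, hL'⟩ := hY
  refine ⟨⟨C * C', ?_⟩, fun x hx => (hL x hx).mul (hL' x hx)⟩
  filter_upwards [hC, hC'] with n h h' x hx hsx
  rw [abs_mul, mul_assoc]
  have h1 := h x hx hsx
  rw [mul_one] at h1
  exact mul_le_mul h1 (h' x hx hsx) (abs_nonneg _) ((abs_nonneg _).trans h1)

theorem of_tendsto {c : ℕ → ℝ} {l : ℝ} (hc : Tendsto c atTop (𝓝 l)) :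
    DominatedLimit s (fun _ => 1) (fun n _ => c n) (fun _ => l) := by
  refine ⟨⟨|l| + 1, ?_⟩, fun x _ => hc⟩
  filter_upwards [hc.abs.eventually_le_const (lt_add_one |l|)] with n h x _ _
  rwa [mul_one]

theorem const (l : ℝ) : DominatedLimit s (fun _ => 1) (fun _ _ => l) (fun _ => l) :=
  of_tendsto tendsto_const_nhds

theorem neg (hX : DominatedLimit s w X L) :
    DominatedLimit s w (fun n x => -X n x) (fun x => -L x) := by
  simpa using (const (-1)).mul hX

theorem sub (hX : DominatedLimit s w X L) (hY : DominatedLimit s w Y L') :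
    DominatedLimit s w (fun n x => X n x - Y n x) (fun x => L x - L' x) := by
  simpa only [sub_eq_add_neg] using hX.add hY.neg

theorem toBounded (hX : DominatedLimit s w X L) (hw : ∀ x, 0 < x → 0 ≤ w x ∧ w x ≤ 1) :
    DominatedLimit s (fun _ => 1) X L := by
  obtain ⟨⟨C, hC⟩, hL⟩ := hX
  refine ⟨⟨|C|, ?_⟩, hL⟩
  filter_upwards [hC] with n h x hx hsx
  refine (h x hx hsx).trans (mul_le_mul (le_abs_self C) (hw x hx).2 (hw x hx).1 (abs_nonneg _))

theorem level (hs : Tendsto s atTop (𝓝 0)) (hpos : ∀ᶠ n in atTop, 0 < s n) :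
    DominatedLimit s (fun _ => 1) (fun n x => 1 - s n * x) (fun _ => 1) := by
  refine ⟨⟨1, ?_⟩, fun x _ => by simpa using (hs.mul_const x).const_sub 1⟩
  filter_upwards [hpos] with n hn x hx hsx
  have : 0 < s n * x := mul_pos hn hx
  rw [abs_of_nonneg (by linarith)]
  linarith

theorem congr' (hX : DominatedLimit s w X L) (h : ∀ᶠ n in atTop, ∀ x, X n x = Y n x)
    (h' : ∀ x, 0 < x → L x = L' x) : DominatedLimit s w Y L' := by
  obtain ⟨⟨C, hC⟩, hL⟩ := hX
  refine ⟨⟨C, ?_⟩, fun x hx => ?_⟩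
  · filter_upwards [hC, h] with n hn he x hx hsx
    rw [← he x]; exact hn x hx hsx
  · rw [← h' x hx]
    exact (hL x hx).congr' (h.mono fun n hn => hn x)

end DominatedLimit

section Scaled

variable {s : ℕ → ℝ} {w : ℝ → ℝ} {ℓ : ℝ → ℝ} {N : ℕ → ℕ} {c : ℝ}

theorem tendsto_sub_div (hN : Tendsto (fun n => (N n : ℝ) / n) atTop (𝓝 c)) (b : ℝ) :
    Tendsto (fun n : ℕ => ((N n : ℝ) - b) / n) atTop (𝓝 c) := by
  have := hN.sub (tendsto_const_div_atTop_nhds_zero_nat b)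
  rw [sub_zero] at this
  exact this.congr fun n => (sub_div _ _ _).symm

theorem tendsto_natSub_div (hN : Tendsto (fun n => (N n : ℝ) / n) atTop (𝓝 c)) (hc : 0 < c)
    (j : ℕ) : Tendsto (fun n : ℕ => ((N n - j : ℕ) : ℝ) / n) atTop (𝓝 c) := by
  refine (tendsto_sub_div hN j).congr' ?_
  have h1 : ∀ᶠ n : ℕ in atTop, 0 < (N n - j : ℝ) / n :=
    (tendsto_sub_div hN j).eventually_const_lt hc
  filter_upwards [h1, eventually_gt_atTop 0] with n h hn
  have hn' : (0 : ℝ) < n := by exact_mod_cast hn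
  have h2 : (0 : ℝ) < N n - j := by
    by_contra hcon
    exact absurd h (not_lt.2 (div_nonpos_of_nonpos_of_nonneg (not_lt.1 hcon) hn'.le))
  rw [Nat.cast_sub (by have : (j : ℝ) ≤ N n := by linarith
                       exact_mod_cast this)]

/-- For moments of order about `c n`, the derivative in the mean contributes the factor `c`, and the
one in the variance `-c ^ 2 / 2`. The two cancel for `c = 2`. -/
theorem DominatedLimit.gaussMomentDeriv (hs : Tendsto s atTop (𝓝 0))
    (hpos : ∀ᶠ n in atTop, 0 < s n) (hc : 0 < c)
    (hN : Tendsto (fun n => (N n : ℝ) / n) atTop (𝓝 c))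
    (hA : ∀ j, DominatedLimit s w (fun n x => gaussMoment n (N n - j) (1 - s n * x)) ℓ) (j : ℕ) :
    DominatedLimit s w (fun n x => DDEVD.gaussMomentDeriv n (N n - j) (1 - s n * x) / n)
      (fun x => (c - c ^ 2 / 2) * ℓ x) := by
  have hNj := tendsto_natSub_div hN hc j
  have h1 := (of_tendsto hNj).mul (hA (j + 1))
  have h2 := (((const 1).sub ((const 2).mul (level hs hpos))).mul
    ((of_tendsto (hNj.mul ((tendsto_sub_div hNj 1).div_const 2))))).mul (hA (j + 2))
  refine (h1.add h2).congr' ?_ fun x _ => by ring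
  filter_upwards [eventually_gt_atTop 0] with n hn x
  have hn' : (n : ℝ) ≠ 0 := by exact_mod_cast hn.ne'
  rw [DDEVD.gaussMomentDeriv, Nat.sub_sub, Nat.sub_sub]
  field_simp

theorem DominatedLimit.curvatureCoeff (a b : ℝ) (hs : Tendsto s atTop (𝓝 0))
    (hpos : ∀ᶠ n in atTop, 0 < s n)
    (hN : Tendsto (fun n => (N n : ℝ) / n) atTop (𝓝 c))
    (hA : ∀ j, DominatedLimit s w (fun n x => gaussMoment n (N n - j) (1 - s n * x)) ℓ) :
    DominatedLimit s w (fun n x => DDEVD.curvatureCoeff a b n (N n) (1 - s n * x) / n)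
      (fun x => (c ^ 2 / 2 * (a / 2 - b) + c / 2 * b) * ℓ x) := by
  have h1 := ((of_tendsto (hN.mul ((tendsto_sub_div hN 1).div_const 2))).mul
    ((const (a / 2)).sub ((level hs hpos).mul (const b)))).mul (hA 2)
  have h2 := (of_tendsto ((hN.div_const 2).mul_const b)).mul (hA 1)
  refine (h1.add h2).congr' ?_ fun x _ => by ring
  filter_upwards [eventually_gt_atTop 0] with n hn x
  have hn' : (n : ℝ) ≠ 0 := by exact_mod_cast hn.ne'
  rw [DDEVD.curvatureCoeff]
  field_simp

theorem DominatedLimit.curvatureCoeffDeriv (a b : ℝ) (hs : Tendsto s atTop (𝓝 0))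
    (hpos : ∀ᶠ n in atTop, 0 < s n) (hc : 0 < c)
    (hN : Tendsto (fun n => (N n : ℝ) / n) atTop (𝓝 c))
    (hA : ∀ j, DominatedLimit s w (fun n x => gaussMoment n (N n - j) (1 - s n * x)) ℓ) :
    DominatedLimit s w (fun n x => DDEVD.curvatureCoeffDeriv a b n (N n) (1 - s n * x) / n ^ 2)
      (fun x => (c ^ 2 / 2 * (a / 2 - b) + c / 2 * b) * ((c - c ^ 2 / 2) * ℓ x)) := by
  have hA' := DominatedLimit.gaussMomentDeriv hs hpos hc hN hA
  have hcc := hN.mul ((tendsto_sub_div hN 1).div_const 2)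
  have h1 := ((of_tendsto hcc).mul
    ((const (a / 2)).sub ((level hs hpos).mul (const b)))).mul (hA' 2)
  have h2 := (of_tendsto ((hN.div_const 2).mul_const b)).mul (hA' 1)
  have h3 := (of_tendsto ((hcc.mul_const b).mul (tendsto_inv_atTop_nhds_zero_nat (𝕜 := ℝ)))).mul
    (hA 2)
  refine ((h1.add h2).sub h3).congr' ?_ fun x _ => by ring
  filter_upwards [eventually_gt_atTop 0] with n hn x
  have hn' : (n : ℝ) ≠ 0 := by exact_mod_cast hn.ne'
  rw [DDEVD.curvatureCoeffDeriv]
  field_simp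
  ring

theorem DominatedLimit.slopeCoeff
    (hN : Tendsto (fun n => (N n : ℝ) / n) atTop (𝓝 c))
    (hA : ∀ j, DominatedLimit s w (fun n x => gaussMoment n (N n - j) (1 - s n * x)) ℓ) :
    DominatedLimit s w (fun n x => DDEVD.slopeCoeff n (N n) (1 - s n * x) / n ^ 2)
      (fun x => c ^ 4 / 8 * ℓ x) := by
  have h1 := (of_tendsto ((((hN.mul (tendsto_sub_div hN 1)).mul (tendsto_sub_div hN 2)).mul
    (tendsto_sub_div hN 3)).div_const 8)).mul (hA 4)
  refine h1.congr' ?_ fun x _ => by ring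
  filter_upwards [eventually_gt_atTop 0] with n hn x
  have hn' : (n : ℝ) ≠ 0 := by exact_mod_cast hn.ne'
  rw [DDEVD.slopeCoeff]
  field_simp

end Scaled

/-! ### Asymptotics of the bias and variance integrals -/

theorem tendsto_natCast_inv_nhds_zero :
    Tendsto (fun n : ℕ => (n : ℝ)⁻¹) atTop (𝓝 0) := tendsto_inv_atTop_nhds_zero_nat

theorem eventually_natCast_inv_pos : ∀ᶠ n : ℕ in atTop, (0 : ℝ) < (n : ℝ)⁻¹ := by
  filter_upwards [eventually_gt_atTop 0] with n hn
  have : (0 : ℝ) < n := by exact_mod_cast hn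
  positivity

theorem tendsto_sqrt_inv_nhds_zero : Tendsto (fun n : ℕ => (√(n : ℝ))⁻¹) atTop (𝓝 0) :=
  (Real.tendsto_sqrt_atTop.comp tendsto_natCast_atTop_atTop).inv_tendsto_atTop

theorem eventually_sqrt_inv_pos : ∀ᶠ n : ℕ in atTop, (0 : ℝ) < (√(n : ℝ))⁻¹ := by
  filter_upwards [eventually_gt_atTop 0] with n hn
  have : (0 : ℝ) < n := by exact_mod_cast hn
  positivity

theorem half_le_natSub {n j : ℕ} (h : 2 * j ≤ n) : (n : ℝ) / 2 ≤ ((n - j : ℕ) : ℝ) := by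
  rw [Nat.cast_sub (by omega)]
  have : (2 : ℝ) * j ≤ n := by exact_mod_cast h
  linarith

theorem dominatedLimit_gaussMoment_inner (j : ℕ) :
    DominatedLimit (fun n => (n : ℝ)⁻¹) (fun x => Real.exp (-(1 / 4) * x))
      (fun n x => gaussMoment n (n - j) (1 - (n : ℝ)⁻¹ * x)) (fun x => Real.exp (-(x / 2))) := by
  refine ⟨⟨2, ?_⟩, fun x hx => ?_⟩
  · filter_upwards [eventually_gt_atTop 0, eventually_ge_atTop (2 * j)] with n hn hj x hx hsx
    have hn' : (0 : ℝ) < n := by exact_mod_cast hn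
    have hsx0 : 0 < (n : ℝ)⁻¹ * x := by positivity
    refine (abs_gaussMoment_le_exp hn.ne' (Nat.sub_le n j) (by linarith) (by linarith)).trans ?_
    refine mul_le_mul_of_nonneg_left (Real.exp_le_exp.2 ?_) zero_le_two
    have h1 := mul_le_mul_of_nonneg_right (half_le_natSub hj) hsx0.le
    have h2 : (n : ℝ) / 2 * ((n : ℝ)⁻¹ * x) = x / 2 := by field_simp
    rw [h2] at h1
    rw [sub_sub_cancel]
    linarith
  · refine (tendsto_gaussMoment_inner j hx).congr fun n => ?_
    rw [div_eq_inv_mul]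

theorem dominatedLimit_pow_inner (j : ℕ) :
    DominatedLimit (fun n => (n : ℝ)⁻¹) (fun x => Real.exp (-(1 / 4) * x))
      (fun n x => (1 - (n : ℝ)⁻¹ * x) ^ (n - j)) (fun x => Real.exp (-x)) := by
  refine ⟨⟨1, ?_⟩, fun x hx => ?_⟩
  · filter_upwards [eventually_gt_atTop 0, eventually_ge_atTop (2 * j)] with n hn hj x hx hsx
    have hn' : (0 : ℝ) < n := by exact_mod_cast hn
    have hsx0 : 0 < (n : ℝ)⁻¹ * x := by positivity
    rw [abs_pow, abs_of_nonneg (by linarith), one_mul]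
    refine (pow_le_pow_left₀ (by linarith) (Real.one_sub_le_exp_neg _) _).trans ?_
    rw [← Real.exp_nat_mul]
    refine Real.exp_le_exp.2 ?_
    have h1 := mul_le_mul_of_nonneg_right (half_le_natSub hj) hsx0.le
    have h2 : (n : ℝ) / 2 * ((n : ℝ)⁻¹ * x) = x / 2 := by field_simp
    rw [h2] at h1
    linarith
  · have h0 : Tendsto (fun n : ℕ => (n : ℝ)⁻¹ * x) atTop (𝓝 0) := by
      simpa using tendsto_natCast_inv_nhds_zero.mul_const x
    refine tendsto_pow_sub_of_tendsto_pow (by simpa using h0.const_sub 1) ?_ j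
    simp only [sub_eq_add_neg]
    refine Real.tendsto_one_add_pow_exp_of_tendsto ?_
    refine tendsto_const_nhds.congr' ?_
    filter_upwards [eventually_gt_atTop 0] with n hn
    have hn' : (n : ℝ) ≠ 0 := by exact_mod_cast hn.ne'
    field_simp

theorem sqrt_scale_sq {n : ℕ} (hn : 0 < n) (x : ℝ) : n * ((√(n : ℝ))⁻¹ * x) ^ 2 = x ^ 2 := by
  have hn' : (0 : ℝ) < n := by exact_mod_cast hn
  rw [mul_pow, inv_pow, Real.sq_sqrt hn'.le]
  field_simp

theorem dominatedLimit_gaussMoment_outer (j : ℕ) :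
    DominatedLimit (fun n => (√(n : ℝ))⁻¹) (fun x => Real.exp (-(1 / 4) * x ^ 2))
      (fun n x => gaussMoment n (2 * n - j) (1 - (√(n : ℝ))⁻¹ * x))
      (fun x => Real.exp (-(3 * x ^ 2))) := by
  refine ⟨⟨2, ?_⟩, fun x hx => ?_⟩
  · filter_upwards [eventually_gt_atTop 0, eventually_ge_atTop j] with n hn hj x hx hsx
    have hn' : (0 : ℝ) < n := by exact_mod_cast hn
    have hsx0 : 0 < (√(n : ℝ))⁻¹ * x := by positivity
    refine (abs_gaussMoment_le_exp_sq hn.ne' (Nat.sub_le _ j) (by linarith)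
      (by linarith)).trans ?_
    refine mul_le_mul_of_nonneg_left (Real.exp_le_exp.2 ?_) zero_le_two
    have h0 : (n : ℝ) ≤ ((2 * n - j : ℕ) : ℝ) := by exact_mod_cast (by omega : n ≤ 2 * n - j)
    have h1 := mul_le_mul_of_nonneg_right h0 (sq_nonneg ((√(n : ℝ))⁻¹ * x))
    rw [sqrt_scale_sq hn] at h1
    rw [sub_sub_cancel]
    nlinarith [sq_nonneg x]
  · refine (tendsto_gaussMoment_outer j hx).congr fun n => ?_
    rw [div_eq_inv_mul]

/-- At the scale `1 - u ∼ x / √n` the moments of order about `n` are negligible. -/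
theorem dominatedLimit_gaussMoment_outer_zero (j : ℕ) :
    DominatedLimit (fun n => (√(n : ℝ))⁻¹) (fun x => Real.exp (-(1 / 4) * x ^ 2))
      (fun n x => gaussMoment n (n - j) (1 - (√(n : ℝ))⁻¹ * x)) (fun _ => 0) := by
  refine ⟨⟨2, ?_⟩, fun x hx => ?_⟩
  · filter_upwards [eventually_gt_atTop 0, eventually_ge_atTop (2 * j)] with n hn hj x hx hsx
    have hn' : (0 : ℝ) < n := by exact_mod_cast hn
    have hsx0 : 0 < (√(n : ℝ))⁻¹ * x := by positivity
    refine (abs_gaussMoment_le_exp_sq hn.ne' (by omega) (by linarith)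
      (by linarith)).trans ?_
    refine mul_le_mul_of_nonneg_left (Real.exp_le_exp.2 ?_) zero_le_two
    have h1 := mul_le_mul_of_nonneg_right (half_le_natSub hj) (sq_nonneg ((√(n : ℝ))⁻¹ * x))
    have h2 := sqrt_scale_sq hn x
    rw [sub_sub_cancel]
    linarith
  · have hsx : Tendsto (fun n : ℕ => (√(n : ℝ))⁻¹ * x) atTop (𝓝 0) := by
      simpa using tendsto_sqrt_inv_nhds_zero.mul_const x
    have hdec : Tendsto (fun n : ℕ => 2 * Real.exp (-(√(n : ℝ) * (x / 4)))) atTop (𝓝 0) := by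
      have h1 : Tendsto (fun n : ℕ => √(n : ℝ) * (x / 4)) atTop atTop :=
        (Real.tendsto_sqrt_atTop.comp tendsto_natCast_atTop_atTop).atTop_mul_const (by positivity)
      have h2 := (Real.tendsto_exp_neg_atTop_nhds_zero.comp h1).const_mul 2
      simpa using h2
    refine squeeze_zero_norm' ?_ hdec
    filter_upwards [eventually_gt_atTop 0, eventually_ge_atTop (2 * j),
      hsx.eventually_le_const zero_lt_one] with n hn hj hsx1
    have hn' : (0 : ℝ) < n := by exact_mod_cast hn
    have hsx0 : 0 < (√(n : ℝ))⁻¹ * x := by positivity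
    refine (abs_gaussMoment_le_exp hn.ne' (Nat.sub_le n j) (by linarith) (by linarith)).trans ?_
    refine mul_le_mul_of_nonneg_left (Real.exp_le_exp.2 ?_) zero_le_two
    have h1 := mul_le_mul_of_nonneg_right (half_le_natSub hj) hsx0.le
    have h2 : (n : ℝ) / 2 * ((√(n : ℝ))⁻¹ * x) = √(n : ℝ) * (x / 2) := by
      have hs : √(n : ℝ) ≠ 0 := (Real.sqrt_pos.2 hn').ne'
      field_simp
      rw [Real.sq_sqrt hn'.le]
    rw [h2] at h1
    rw [sub_sub_cancel]
    linarith

section Boundary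

variable {q c : ℝ} {N : ℕ → ℕ}

/-- At a fixed level `q < 1` the moments decay exponentially. -/
theorem tendsto_rpow_mul_gaussMoment (hq0 : 0 ≤ q) (hq1 : q < 1) (hc : 0 < c)
    (hN : Tendsto (fun n => (N n : ℝ) / n) atTop (𝓝 c)) (hN2 : ∀ n, N n ≤ 2 * n) (p : ℝ) (j : ℕ) :
    Tendsto (fun n : ℕ => (n : ℝ) ^ p * gaussMoment n (N n - j) q) atTop (𝓝 0) := by
  have hd : 0 < c * (1 - q) ^ 2 / 4 := by
    have : 0 < 1 - q := by linarith
    positivity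
  have h1 := ((tendsto_rpow_mul_exp_neg_mul_atTop_nhds_zero p _ hd).comp
    tendsto_natCast_atTop_atTop).const_mul 2
  rw [mul_zero] at h1
  refine squeeze_zero_norm' ?_ h1
  filter_upwards [eventually_gt_atTop 0,
    (tendsto_natSub_div hN hc j).eventually_const_le (half_lt_self hc)] with n hn hcn
  have hn' : (0 : ℝ) < n := by exact_mod_cast hn
  rw [norm_mul, Real.norm_eq_abs, Real.norm_eq_abs, abs_of_nonneg (Real.rpow_nonneg hn'.le p)]
  have h2 := abs_gaussMoment_le_exp_sq hn.ne' ((Nat.sub_le _ j).trans (hN2 n)) hq0 hq1.le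
  have h3 : Real.exp (-(((N n - j : ℕ) : ℝ) * (1 - q) ^ 2 / 2))
      ≤ Real.exp (-(c * (1 - q) ^ 2 / 4) * n) := by
    refine Real.exp_le_exp.2 ?_
    rw [le_div_iff₀ hn'] at hcn
    nlinarith [mul_le_mul_of_nonneg_right hcn (sq_nonneg (1 - q))]
  simp only [Function.comp]
  calc (n : ℝ) ^ p * |gaussMoment n (N n - j) q|
      ≤ (n : ℝ) ^ p * (2 * Real.exp (-(c * (1 - q) ^ 2 / 4) * n)) :=
        mul_le_mul_of_nonneg_left (h2.trans (by linarith)) (Real.rpow_nonneg hn'.le p)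
    _ = _ := by ring

theorem tendsto_rpow_mul_curvatureCoeff (hq0 : 0 ≤ q) (hq1 : q < 1) (hc : 0 < c)
    (hN : Tendsto (fun n => (N n : ℝ) / n) atTop (𝓝 c)) (hN2 : ∀ n, N n ≤ 2 * n) (s m p : ℝ) :
    Tendsto (fun n : ℕ => (n : ℝ) ^ p * curvatureCoeff s m n (N n) q) atTop (𝓝 0) := by
  have hA := tendsto_rpow_mul_gaussMoment hq0 hq1 hc hN hN2 (p + 1)
  have h1 := ((hN.mul ((tendsto_sub_div hN 1).div_const 2)).mul_const (s / 2 - q * m)).mul (hA 2)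
  have h2 := ((hN.div_const 2).mul_const m).mul (hA 1)
  have h3 := h1.add h2
  simp only [mul_zero, add_zero] at h3
  refine h3.congr' ?_
  filter_upwards [eventually_gt_atTop 0] with n hn
  have hn' : (0 : ℝ) < n := by exact_mod_cast hn
  rw [curvatureCoeff, Real.rpow_add_one hn'.ne']
  field_simp

end Boundary

theorem tendsto_natCast_div_self : Tendsto (fun n : ℕ => (n : ℝ) / n) atTop (𝓝 1) := by
  refine tendsto_const_nhds.congr' ?_
  filter_upwards [eventually_gt_atTop 0] with n hn
  have hn' : (n : ℝ) ≠ 0 := by exact_mod_cast hn.ne'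
  field_simp

theorem tendsto_two_mul_natCast_div_self :
    Tendsto (fun n : ℕ => ((2 * n : ℕ) : ℝ) / n) atTop (𝓝 2) := by
  refine tendsto_const_nhds.congr' ?_
  filter_upwards [eventually_gt_atTop 0] with n hn
  have hn' : (n : ℝ) ≠ 0 := by exact_mod_cast hn.ne'
  push_cast
  field_simp

theorem tendsto_rpow_mul_biasCurvature {q : ℝ} (hq0 : 0 ≤ q) (hq1 : q < 1) (s m p : ℝ) :
    Tendsto (fun n : ℕ => (n : ℝ) ^ p * biasCurvature s m n q) atTop (𝓝 0) := by
  have h1 := tendsto_rpow_mul_curvatureCoeff hq0 hq1 one_pos tendsto_natCast_div_self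
    (fun n => by omega) s m p
  have h2 := tendsto_rpow_mul_gaussMoment hq0 hq1 one_pos tendsto_natCast_div_self
    (fun n => by omega) 0 0
  have h3 := (h2.sub (tendsto_pow_atTop_nhds_zero_of_lt_one hq0 hq1)).mul h1
  simp only [mul_zero] at h3
  refine h3.congr fun n => ?_
  rw [Real.rpow_zero, Nat.sub_zero, biasCurvature]
  ring

theorem tendsto_rpow_mul_varCurvature {q : ℝ} (hq0 : 0 ≤ q) (hq1 : q < 1) (s m p : ℝ) :
    Tendsto (fun n : ℕ => (n : ℝ) ^ p * varCurvature s m n q) atTop (𝓝 0) := by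
  have h1 := tendsto_rpow_mul_curvatureCoeff hq0 hq1 one_pos tendsto_natCast_div_self
    (fun n => by omega) s m p
  have h2 := tendsto_rpow_mul_gaussMoment hq0 hq1 one_pos tendsto_natCast_div_self
    (fun n => by omega) 0 0
  have h4 := tendsto_rpow_mul_curvatureCoeff hq0 hq1 two_pos tendsto_two_mul_natCast_div_self
    (fun n => le_rfl) s m p
  have h3 := h4.sub ((h2.const_mul 2).mul h1)
  simp only [mul_zero, sub_zero] at h3
  refine h3.congr fun n => ?_
  rw [Real.rpow_zero, Nat.sub_zero, varCurvature]
  ring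

/-- The scaled integrand of the bias integral after integration by parts. -/
theorem dominatedLimit_bias (s m c : ℝ) :
    DominatedLimit (fun n => (n : ℝ)⁻¹) (fun x => Real.exp (-(1 / 4) * x))
      (fun n x => (biasSlope c n (1 - (n : ℝ)⁻¹ * x)
        - biasCurvatureDeriv s m n (1 - (n : ℝ)⁻¹ * x)) / n ^ 2)
      (fun x => c ^ 2 / 8 * (Real.exp (-(1 * x)) - Real.exp (-(3 / 2 * x)))
        - s / 4 * (Real.exp (-(1 * x)) - 3 / 2 * Real.exp (-(3 / 2 * x)))) := by
  have hw : ∀ x : ℝ, 0 < x → 0 ≤ Real.exp (-(1 / 4) * x) ∧ Real.exp (-(1 / 4) * x) ≤ 1 :=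
    fun x hx => ⟨(Real.exp_pos _).le, Real.exp_le_one_iff.2 (by linarith)⟩
  have hs := tendsto_natCast_inv_nhds_zero
  have hp := eventually_natCast_inv_pos
  have hN := tendsto_natCast_div_self
  have hA := dominatedLimit_gaussMoment_inner
  have hA' := DominatedLimit.gaussMomentDeriv hs hp one_pos hN hA 0
  have hL := DominatedLimit.curvatureCoeff s m hs hp hN hA
  have hL' := DominatedLimit.curvatureCoeffDeriv s m hs hp one_pos hN hA
  have hR := DominatedLimit.slopeCoeff hN hA
  have hb := ((hA 0).sub (dominatedLimit_pow_inner 0)).toBounded hw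
  have hb' := (hA'.sub (dominatedLimit_pow_inner 1)).toBounded hw
  refine ((hb.mul ((DominatedLimit.const (c ^ 2)).mul hR)).sub
    ((hb'.mul hL).add (hb.mul hL'))).congr' ?_ fun x _ => ?_
  · filter_upwards [eventually_gt_atTop 0] with n hn x
    have hn' : (n : ℝ) ≠ 0 := by exact_mod_cast hn.ne'
    rw [biasSlope, biasCurvatureDeriv, Nat.sub_zero]
    field_simp
  · have e1 : Real.exp (-(1 * x)) = Real.exp (-(x / 2)) ^ 2 := by
      rw [← Real.exp_nat_mul]; congr 1; push_cast; ring
    have e2 : Real.exp (-(3 / 2 * x)) = Real.exp (-(x / 2)) ^ 3 := by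
      rw [← Real.exp_nat_mul]; congr 1; push_cast; ring
    have e3 : Real.exp (-x) = Real.exp (-(x / 2)) ^ 2 := by
      rw [← Real.exp_nat_mul]; congr 1; push_cast; ring
    rw [e1, e2, e3]
    ring

/-- The scaled integrand of the variance integral after integration by parts. The part of `V_2`
with the second derivative of `F` does not contribute: the derivative in the mean and the derivative
in the variance of the moments of order about `2 n` cancel to leading order. -/
theorem dominatedLimit_var (s m c : ℝ) :
    DominatedLimit (fun n => (√(n : ℝ))⁻¹) (fun x => Real.exp (-(1 / 4) * x ^ 2))
      (fun n x => (varSlope c n (1 - (√(n : ℝ))⁻¹ * x)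
        - varCurvatureDeriv s m n (1 - (√(n : ℝ))⁻¹ * x)) / n ^ 2)
      (fun x => 2 * c ^ 2 * Real.exp (-(3 * x ^ 2))) := by
  have hw : ∀ x : ℝ, 0 < x →
      0 ≤ Real.exp (-(1 / 4) * x ^ 2) ∧ Real.exp (-(1 / 4) * x ^ 2) ≤ 1 :=
    fun x hx => ⟨(Real.exp_pos _).le, Real.exp_le_one_iff.2 (by nlinarith [sq_nonneg x])⟩
  have hs := tendsto_sqrt_inv_nhds_zero
  have hp := eventually_sqrt_inv_pos
  have hN := tendsto_natCast_div_self
  have hN2 := tendsto_two_mul_natCast_div_self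
  have hA := dominatedLimit_gaussMoment_outer_zero
  have hB := dominatedLimit_gaussMoment_outer
  have hA' := DominatedLimit.gaussMomentDeriv hs hp one_pos hN hA 0
  have hL := DominatedLimit.curvatureCoeff s m hs hp hN hA
  have hL' := DominatedLimit.curvatureCoeffDeriv s m hs hp one_pos hN hA
  have hR := DominatedLimit.slopeCoeff hN hA
  have hM' := DominatedLimit.curvatureCoeffDeriv s m hs hp two_pos hN2 hB
  have hS := DominatedLimit.slopeCoeff hN2 hB
  have hA0 := (hA 0).toBounded hw
  have hA2 := (DominatedLimit.of_tendsto (hN.mul ((tendsto_sub_div hN 1).div_const 2))).mul (hA 2)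
  have h1 := (DominatedLimit.const (c ^ 2)).mul
    ((hS.sub ((DominatedLimit.const 2).mul (hA0.mul hR))).sub ((hA2.toBounded hw).mul hA2))
  have h2 := hM'.sub ((DominatedLimit.const 2).mul
    (((hA'.toBounded hw).mul hL).add (hA0.mul hL')))
  refine (h1.sub h2).congr' ?_ fun x _ => by ring
  filter_upwards [eventually_gt_atTop 0] with n hn x
  have hn' : (n : ℝ) ≠ 0 := by exact_mod_cast hn.ne'
  rw [varSlope, varCurvatureDeriv, Nat.sub_zero]
  field_simp

theorem integrableOn_rpow_mul_exp {p : ℝ} (hp : -1 < p) {r : ℝ} (hr : 0 < r) :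
    IntegrableOn (fun x : ℝ => x ^ p * Real.exp (-(r * x))) (Set.Ioi 0) := by
  have := integrableOn_rpow_mul_exp_neg_mul_rpow (p := 1) hp one_pos hr
  simpa only [Real.rpow_one, neg_mul] using this

theorem integral_bias_limit {γ : ℝ} (hγ : -1 < γ) (s c : ℝ) :
    ∫ x in Set.Ioi (0 : ℝ), x ^ (γ + 1)
      * (c ^ 2 / 8 * (Real.exp (-(1 * x)) - Real.exp (-(3 / 2 * x)))
        - s / 4 * (Real.exp (-(1 * x)) - 3 / 2 * Real.exp (-(3 / 2 * x))))
      = -(Real.Gamma (γ + 2) * (s / 4 * (1 - (2 / 3 : ℝ) ^ (γ + 1))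
          - c ^ 2 / 8 * (1 - (2 / 3 : ℝ) ^ (γ + 2)))) := by
  have i1 := integrableOn_rpow_mul_exp (p := γ + 1) (by linarith) one_pos
  have i2 := integrableOn_rpow_mul_exp (p := γ + 1) (by linarith) (r := 3 / 2) (by norm_num)
  have v1 := Real.integral_rpow_mul_exp_neg_mul_Ioi (a := γ + 2) (by linarith) one_pos
  have v2 := Real.integral_rpow_mul_exp_neg_mul_Ioi (a := γ + 2) (by linarith) (r := 3 / 2)
    (by norm_num)
  rw [show γ + 2 - 1 = γ + 1 by ring] at v1 v2
  have e : ∀ x : ℝ, x ^ (γ + 1)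
      * (c ^ 2 / 8 * (Real.exp (-(1 * x)) - Real.exp (-(3 / 2 * x)))
        - s / 4 * (Real.exp (-(1 * x)) - 3 / 2 * Real.exp (-(3 / 2 * x))))
      = (c ^ 2 / 8 - s / 4) * (x ^ (γ + 1) * Real.exp (-(1 * x)))
        + (3 * s / 8 - c ^ 2 / 8) * (x ^ (γ + 1) * Real.exp (-(3 / 2 * x))) := fun x => by ring
  simp only [e]
  have e1 : (2 / 3 : ℝ) ^ (γ + 2) = (2 / 3 : ℝ) ^ (γ + 1) * (2 / 3) := by
    rw [← Real.rpow_add_one (by norm_num)]; congr 1; ring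
  rw [integral_add (i1.const_mul _) (i2.const_mul _), integral_const_mul, integral_const_mul, v1,
    v2, show (1 / (3 / 2) : ℝ) = 2 / 3 by norm_num, e1, div_one, Real.one_rpow]
  ring

theorem integral_var_limit {γ : ℝ} (hγ : -1 < γ) (c : ℝ) :
    ∫ x in Set.Ioi (0 : ℝ), x ^ (γ + 1) * (2 * c ^ 2 * Real.exp (-(3 * x ^ 2)))
      = c ^ 2 * Real.Gamma (γ / 2 + 1) * (3 : ℝ) ^ (-1 - γ / 2) := by
  have v := integral_rpow_mul_exp_neg_mul_rpow (p := 2) (q := γ + 1) (b := 3) two_pos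
    (by linarith) (by norm_num)
  have e : ∀ x : ℝ, x ^ (γ + 1) * (2 * c ^ 2 * Real.exp (-(3 * x ^ 2)))
      = 2 * c ^ 2 * (x ^ (γ + 1) * Real.exp (-3 * x ^ (2 : ℝ))) := by
    intro x
    rw [Real.rpow_two, neg_mul]; ring
  simp only [e]
  rw [integral_const_mul, v, show (γ + 1 + 1) / 2 = γ / 2 + 1 by ring,
    show -(γ + 1 + 1) / 2 = -1 - γ / 2 by ring]
  ring

namespace RegularTail

variable {F : ℝ → ℝ} {q a γ D M : ℝ}

theorem integral_add_eq (h : RegularTail F q a γ D M) {φ φ' ψ : ℝ → ℝ}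
    (hφ : ∀ u, HasDerivAt φ (φ' u) u) (hφ' : Continuous φ') (hψ : Continuous ψ) :
    ∫ y in Set.Ici a, (deriv (deriv F) y * φ (F y) + deriv F y ^ 2 * ψ (F y))
      = -(deriv F a * φ q) + ∫ y in Set.Ici a, deriv F y ^ 2 * (ψ (F y) - φ' (F y)) := by
  have hφc : Continuous φ := continuous_iff_continuousAt.2 fun u => (hφ u).continuousAt
  have i1 := h.integrableOn_mul_comp h.integrable_deriv_deriv hφc
  have i2 := h.integrableOn_mul_comp h.integrableOn_deriv_sq hψ
  have i3 := h.integrableOn_mul_comp h.integrableOn_deriv_sq hφ'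
  simp only [mul_sub]
  rw [integral_add i1 i2, integral_sub i2 i3, h.integral_deriv_deriv_mul hφ hφ']
  ring

/-- After integration by parts the integrand is of order `n ^ 2` and lives at the scale
`1 - F y ∼ x / n`; the boundary term at the level `q` is exponentially small. -/
theorem tendsto_bias (h : RegularTail F q a γ D M) (s m c : ℝ) :
    Tendsto (fun n : ℕ => (n : ℝ) ^ γ * ∫ y in Set.Ici a,
      (deriv (deriv F) y * biasCurvature s m n (F y) + deriv F y ^ 2 * biasSlope c n (F y)))
      atTop (𝓝 (-(D * Real.Gamma (γ + 2) * (s / 4 * (1 - (2 / 3 : ℝ) ^ (γ + 1))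
          - c ^ 2 / 8 * (1 - (2 / 3 : ℝ) ^ (γ + 2)))))) := by
  obtain ⟨⟨C, hC⟩, hlim⟩ := dominatedLimit_bias s m c
  have hH : IntegrableOn (fun x : ℝ => x ^ (γ + 1) * (C * Real.exp (-(1 / 4) * x)))
      (Set.Ioi 0) := by
    refine ((integrableOn_rpow_mul_exp (p := γ + 1) (by linarith [h.neg_one_lt]) (r := 1 / 4)
      (by norm_num)).const_mul C).congr (Eventually.of_forall fun x => ?_)
    simp only [neg_mul]; ring
  have key := h.tendsto_integral_sq_mul
    (ψ := fun n u => (biasSlope c n u - biasCurvatureDeriv s m n u) / n ^ 2)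
    (fun n => ((continuous_biasSlope c n).sub (continuous_biasCurvatureDeriv s m n)).div_const _)
    eventually_natCast_inv_pos tendsto_natCast_inv_nhds_zero hC hH hlim
  rw [integral_bias_limit h.neg_one_lt] at key
  have hbd := (tendsto_rpow_mul_biasCurvature h.q_pos.le h.q_lt_one s m γ).const_mul (-deriv F a)
  have hsum := hbd.add key
  rw [mul_zero, zero_add] at hsum
  rw [show -(D * Real.Gamma (γ + 2) * (s / 4 * (1 - (2 / 3 : ℝ) ^ (γ + 1))
    - c ^ 2 / 8 * (1 - (2 / 3 : ℝ) ^ (γ + 2)))) = D * -(Real.Gamma (γ + 2) *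
    (s / 4 * (1 - (2 / 3 : ℝ) ^ (γ + 1)) - c ^ 2 / 8 * (1 - (2 / 3 : ℝ) ^ (γ + 2)))) by ring]
  refine hsum.congr' ?_
  filter_upwards [eventually_gt_atTop 0] with n hn
  have hn' : (0 : ℝ) < n := by exact_mod_cast hn
  rw [h.integral_add_eq (hasDerivAt_biasCurvature s m hn.ne') (continuous_biasCurvatureDeriv s m n)
    (continuous_biasSlope c n)]
  have e1 : ∀ y, deriv F y ^ 2 * ((biasSlope c n (F y) - biasCurvatureDeriv s m n (F y)) / n ^ 2)
      = ((n : ℝ) ^ 2)⁻¹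
        * (deriv F y ^ 2 * (biasSlope c n (F y) - biasCurvatureDeriv s m n (F y))) := by
    intro y; ring
  simp only [e1]
  rw [integral_const_mul]
  have e2 : ((n : ℝ)⁻¹) ^ (-(γ + 2)) * ((n : ℝ) ^ 2)⁻¹ = (n : ℝ) ^ γ := by
    rw [Real.inv_rpow hn'.le, ← Real.rpow_neg hn'.le, neg_neg, Real.rpow_add hn', Real.rpow_two]
    field_simp
  rw [← mul_assoc (_ ^ (-(γ + 2))), e2]
  ring

/-- After integration by parts the integrand is of order `n ^ 2` and lives at the scale
`1 - F y ∼ x / √n`; the boundary term at the level `q` is exponentially small. -/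
theorem tendsto_var (h : RegularTail F q a γ D M) (s m c : ℝ) :
    Tendsto (fun n : ℕ => (∫ y in Set.Ici a,
      (deriv (deriv F) y * varCurvature s m n (F y) + deriv F y ^ 2 * varSlope c n (F y)))
        / (n : ℝ) ^ (1 - γ / 2))
      atTop (𝓝 (D * c ^ 2 * Real.Gamma (γ / 2 + 1) * (3 : ℝ) ^ (-1 - γ / 2))) := by
  obtain ⟨⟨C, hC⟩, hlim⟩ := dominatedLimit_var s m c
  have hH : IntegrableOn (fun x : ℝ => x ^ (γ + 1) * (C * Real.exp (-(1 / 4) * x ^ 2)))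
      (Set.Ioi 0) := by
    refine ((integrableOn_rpow_mul_exp_neg_mul_rpow (p := 2) (s := γ + 1) (b := 1 / 4)
      (by linarith [h.neg_one_lt]) two_pos
      (by norm_num)).const_mul C).congr (Eventually.of_forall fun x => ?_)
    simp only [Real.rpow_two]; ring
  have key := h.tendsto_integral_sq_mul
    (ψ := fun n u => (varSlope c n u - varCurvatureDeriv s m n u) / n ^ 2)
    (fun n => ((continuous_varSlope c n).sub (continuous_varCurvatureDeriv s m n)).div_const _)
    eventually_sqrt_inv_pos tendsto_sqrt_inv_nhds_zero hC hH hlim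
  rw [integral_var_limit h.neg_one_lt] at key
  have hbd := (tendsto_rpow_mul_varCurvature h.q_pos.le h.q_lt_one s m (-(1 - γ / 2))).const_mul
    (-deriv F a)
  have hsum := hbd.add key
  rw [mul_zero, zero_add] at hsum
  rw [show D * c ^ 2 * Real.Gamma (γ / 2 + 1) * (3 : ℝ) ^ (-1 - γ / 2)
    = D * (c ^ 2 * Real.Gamma (γ / 2 + 1) * (3 : ℝ) ^ (-1 - γ / 2)) by ring]
  refine hsum.congr' ?_
  filter_upwards [eventually_gt_atTop 0] with n hn
  have hn' : (0 : ℝ) < n := by exact_mod_cast hn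
  rw [h.integral_add_eq (hasDerivAt_varCurvature s m hn.ne') (continuous_varCurvatureDeriv s m n)
    (continuous_varSlope c n)]
  have e1 : ∀ y, deriv F y ^ 2 * ((varSlope c n (F y) - varCurvatureDeriv s m n (F y)) / n ^ 2)
      = ((n : ℝ) ^ 2)⁻¹
        * (deriv F y ^ 2 * (varSlope c n (F y) - varCurvatureDeriv s m n (F y))) := by
    intro y; ring
  simp only [e1]
  rw [integral_const_mul]
  have e2 : ((√(n : ℝ))⁻¹) ^ (-(γ + 2)) * ((n : ℝ) ^ 2)⁻¹ = (n : ℝ) ^ (-(1 - γ / 2)) := by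
    rw [Real.inv_rpow (Real.sqrt_nonneg _), ← Real.rpow_neg (Real.sqrt_nonneg _), neg_neg,
      Real.sqrt_eq_rpow, ← Real.rpow_mul hn'.le, ← Real.rpow_two, ← Real.rpow_neg hn'.le,
      ← Real.rpow_add hn']
    congr 1; ring
  rw [← mul_assoc (_ ^ (-(γ + 2))), e2, Real.rpow_neg hn'.le]
  ring

end RegularTail

/-! ### Moments of CDF kernels -/

namespace IsCDFKernel

variable {K : ℝ → ℝ}

theorem nonneg (hK : IsCDFKernel K) (u : ℝ) : 0 ≤ K u :=
  hK.mono.le_of_tendsto hK.tendsto_atBot u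

theorem le_one (hK : IsCDFKernel K) (u : ℝ) : K u ≤ 1 :=
  hK.mono.ge_of_tendsto hK.tendsto_atTop u

theorem deriv_nonneg (hK : IsCDFKernel K) (u : ℝ) : 0 ≤ deriv K u := hK.mono.deriv_nonneg

theorem integrable_deriv (hK : IsCDFKernel K) : Integrable (deriv K) := by
  have ha : Tendsto (fun n : ℕ => -(n : ℝ)) atTop atBot :=
    tendsto_neg_atTop_atBot.comp tendsto_natCast_atTop_atTop
  refine integrable_of_intervalIntegral_norm_bounded 1 (fun n : ℕ => ?_) ha
    tendsto_natCast_atTop_atTop (Eventually.of_forall fun n => ?_)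
  · have h := (hK.absCont (-(n : ℝ)) n).intervalIntegrable_deriv
    rwa [intervalIntegrable_iff_integrableOn_Ioc_of_le (by
      have : (0 : ℝ) ≤ n := Nat.cast_nonneg n
      linarith)] at h
  · have h := (hK.absCont (-(n : ℝ)) n).integral_deriv_eq_sub
    have e : ∀ x, ‖deriv K x‖ = deriv K x := fun x => by
      rw [Real.norm_eq_abs, abs_of_nonneg (hK.deriv_nonneg x)]
    simp only [e]
    rw [h]
    linarith [hK.le_one n, hK.nonneg (-(n : ℝ))]

theorem integrable_id_mul_deriv (hK : IsCDFKernel K) : Integrable (fun u => u * deriv K u) := by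
  refine (hK.integrable_deriv.add hK.moment).mono'
    (measurable_id.mul (measurable_deriv K)).aestronglyMeasurable (Eventually.of_forall fun u => ?_)
  have h := hK.deriv_nonneg u
  rw [Real.norm_eq_abs, abs_mul, abs_of_nonneg h]
  simp only [Pi.add_apply]
  have h1 : |u| ≤ 1 + u ^ 2 := by
    rw [← sq_abs]; nlinarith [sq_nonneg (|u| - 1), abs_nonneg u]
  nlinarith

/-- Multiplying by a bounded measurable function of the kernel preserves integrability. -/
theorem integrable_mul_comp (hK : IsCDFKernel K) {g : ℝ → ℝ} (hg : Integrable g) {φ : ℝ → ℝ}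
    (hφ : Continuous φ) : Integrable (fun u => φ (K u) * g u) := by
  obtain ⟨B, hB⟩ := isCompact_Icc.exists_bound_of_continuousOn (s := Set.Icc (0 : ℝ) 1)
    hφ.continuousOn
  exact Integrable.bdd_mul (c := B) hg (hφ.measurable.comp hK.mono.measurable).aestronglyMeasurable
    (Eventually.of_forall fun u => hB _ ⟨hK.nonneg u, hK.le_one u⟩)

theorem ae_hasDerivAt (hK : IsCDFKernel K) : ∀ᵐ u, HasDerivAt K (deriv K u) u := by
  filter_upwards [hK.mono.ae_differentiableAt] with u hu using hu.hasDerivAt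

theorem muSq_eq (hK : IsCDFKernel K) (p : ℕ) :
    muSq K p = ∫ u, 2 * K u * (u ^ p * deriv K u) := by
  rw [muSq, mu]
  refine integral_congr_ae ?_
  filter_upwards [hK.ae_hasDerivAt] with u hu
  have : deriv (fun u => K u ^ 2) u = 2 * K u * deriv K u := by
    simpa using (hu.fun_pow 2).deriv
  rw [this]; ring

/-- The fundamental theorem of calculus on the whole line. -/
theorem integral_eq_sub_of_absolutelyContinuous {G g : ℝ → ℝ} {A B : ℝ}
    (hG : ∀ a b : ℝ, AbsolutelyContinuousOnInterval G a b)
    (hg : ∀ᵐ u, HasDerivAt G (g u) u) (hgi : Integrable g)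
    (hbot : Tendsto G atBot (𝓝 A)) (htop : Tendsto G atTop (𝓝 B)) : ∫ u, g u = B - A := by
  have ha : Tendsto (fun n : ℕ => -(n : ℝ)) atTop atBot :=
    tendsto_neg_atTop_atBot.comp tendsto_natCast_atTop_atTop
  have h1 := intervalIntegral_tendsto_integral hgi ha tendsto_natCast_atTop_atTop
  have h2 : Tendsto (fun n : ℕ => G n - G (-(n : ℝ))) atTop (𝓝 (B - A)) :=
    (htop.comp tendsto_natCast_atTop_atTop).sub (hbot.comp ha)
  refine tendsto_nhds_unique h1 (h2.congr fun n => ?_)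
  rw [← (hG (-(n : ℝ)) n).integral_deriv_eq_sub]
  refine intervalIntegral.integral_congr_ae ?_
  filter_upwards [hg] with u hu _ using hu.deriv

theorem absCont_sub_const (hK : IsCDFKernel K) (k a b : ℝ) :
    AbsolutelyContinuousOnInterval (fun u => K u - k) a b :=
  (hK.absCont a b).sub (LipschitzOnWith.absolutelyContinuousOnInterval (K := 0)
    ((LipschitzWith.const k).lipschitzOnWith))

/-- For a centred kernel `μ_{K²,1}` is the integral of `2 u (K u - K 0) K' u ≥ 0`. If it vanished,
then `(K - K 0) ^ 2`, being absolutely continuous, would be constant. -/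
theorem muSq_one_pos (hK : IsCDFKernel K) (hmean : mu K 1 = 0) : 0 < muSq K 1 := by
  have i1 := hK.integrable_id_mul_deriv
  have i2 : Integrable (fun u => 2 * K u * (u * deriv K u)) :=
    hK.integrable_mul_comp (φ := fun k => 2 * k) i1 (by fun_prop)
  have hmean' : ∫ u, u * deriv K u = 0 := by simpa [mu] using hmean
  have e : muSq K 1 = ∫ u, 2 * (u * (K u - K 0) * deriv K u) := by
    have h1 : muSq K 1 = ∫ u, 2 * K u * (u * deriv K u) := by simpa using hK.muSq_eq 1
    have h2 : ∀ u, 2 * (u * (K u - K 0) * deriv K u)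
        = 2 * K u * (u * deriv K u) - 2 * K 0 * (u * deriv K u) := fun u => by ring
    simp only [h2]
    rw [integral_sub i2 (i1.const_mul _), integral_const_mul, hmean', h1]
    ring
  have hnn : ∀ u, 0 ≤ 2 * (u * (K u - K 0) * deriv K u) := by
    intro u
    refine mul_nonneg zero_le_two (mul_nonneg ?_ (hK.deriv_nonneg u))
    rcases le_total 0 u with h | h
    · exact mul_nonneg h (sub_nonneg.2 (hK.mono h))
    · exact mul_nonneg_of_nonpos_of_nonpos h (sub_nonpos.2 (hK.mono h))
  have hint : Integrable (fun u => 2 * (u * (K u - K 0) * deriv K u)) := by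
    refine (i2.sub (i1.const_mul (2 * K 0))).congr (Eventually.of_forall fun u => ?_)
    simp only [Pi.sub_apply]; ring
  refine lt_of_le_of_ne (e ▸ integral_nonneg hnn) fun h0 => ?_
  rw [e, eq_comm, integral_eq_zero_iff_of_nonneg hnn hint] at h0
  have hac : ∀ a b : ℝ, AbsolutelyContinuousOnInterval (fun u => (K u - K 0) * (K u - K 0)) a b :=
    fun a b => (hK.absCont_sub_const (K 0) a b).mul (hK.absCont_sub_const (K 0) a b)
  have hd : ∀ᵐ u, deriv (fun u => (K u - K 0) * (K u - K 0)) u = 0 := by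
    filter_upwards [h0, hK.ae_hasDerivAt, Measure.ae_ne volume (0 : ℝ)] with u h1 h2 h3
    have h4 := ((h2.sub_const (K 0)).mul (h2.sub_const (K 0))).deriv
    have h5 : (K u - K 0) * deriv K u = 0 := by
      have h6 : 2 * (u * (K u - K 0) * deriv K u) = 0 := h1
      have h7 : u * ((K u - K 0) * deriv K u) = 0 := by linarith
      exact (mul_eq_zero.1 h7).resolve_left h3
    refine h4.trans ?_
    linear_combination 2 * h5
  have hconst : ∀ u, K u = K 0 := by
    intro u
    have h1 := (hac 0 u).integral_deriv_eq_sub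
    rw [intervalIntegral.integral_congr_ae (g := fun _ => 0) (hd.mono fun v hv _ => hv)] at h1
    simp only [intervalIntegral.integral_zero, sub_self, mul_zero, sub_zero] at h1
    exact sub_eq_zero.1 (mul_self_eq_zero.1 h1.symm)
  have h1 := tendsto_nhds_unique hK.tendsto_atBot
    (tendsto_const_nhds.congr fun u => (hconst u).symm)
  have h2 := tendsto_nhds_unique hK.tendsto_atTop
    (tendsto_const_nhds.congr fun u => (hconst u).symm)
  linarith

/-- For `Z` of distribution function `K`, the variable `2 K(Z) - 1` is uniform on `[-1, 1]`. -/
theorem integral_sq_mul_deriv (hK : IsCDFKernel K) :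
    ∫ u, (2 * K u - 1) ^ 2 * deriv K u = 1 / 3 := by
  have hi : Integrable (fun u => (2 * K u - 1) ^ 2 * deriv K u) :=
    hK.integrable_mul_comp (φ := fun k => (2 * k - 1) ^ 2) hK.integrable_deriv (by fun_prop)
  have hac : ∀ a b : ℝ, AbsolutelyContinuousOnInterval
      (fun u => (K u - 1 / 2) * ((K u - 1 / 2) * (K u - 1 / 2))) a b := fun a b =>
    (hK.absCont_sub_const (1 / 2) a b).mul
      ((hK.absCont_sub_const (1 / 2) a b).mul (hK.absCont_sub_const (1 / 2) a b))
  have hd : ∀ᵐ u, HasDerivAt (fun u => (K u - 1 / 2) * ((K u - 1 / 2) * (K u - 1 / 2)))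
      (3 / 4 * ((2 * K u - 1) ^ 2 * deriv K u)) u := by
    filter_upwards [hK.ae_hasDerivAt] with u hu
    have h1 := hu.sub_const (1 / 2)
    refine (h1.mul (h1.mul h1)).congr_deriv ?_
    simp only [Pi.mul_apply]
    ring
  have hlim : ∀ {l : Filter ℝ} {k : ℝ}, Tendsto K l (𝓝 k) → Tendsto
      (fun u => (K u - 1 / 2) * ((K u - 1 / 2) * (K u - 1 / 2))) l
      (𝓝 ((k - 1 / 2) * ((k - 1 / 2) * (k - 1 / 2)))) := fun h =>
    (h.sub_const _).mul ((h.sub_const _).mul (h.sub_const _))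
  have key := integral_eq_sub_of_absolutelyContinuous hac hd (hi.const_mul _)
    (hlim hK.tendsto_atBot) (hlim hK.tendsto_atTop)
  rw [integral_const_mul] at key
  linarith

/-- For a centred symmetric kernel, `3 μ_{K²,1} ^ 2 ≤ μ_{K²,2}`. With `Z` of distribution function
`K` this is the Cauchy–Schwarz inequality for `Z` and `2 K(Z) - 1`, the latter of second moment
`1 / 3`; by symmetry `μ_{K²,2} = μ_{K,2}`. -/
theorem three_mul_muSq_one_sq_le (hK : IsCDFKernel K) (hmean : mu K 1 = 0)
    (hsym : ∀ u : ℝ, K (-u) = 1 - K u) : 3 * muSq K 1 ^ 2 ≤ muSq K 2 := by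
  have i1 := hK.integrable_id_mul_deriv
  have i2 := hK.moment
  have j1 : Integrable (fun u => 2 * K u * (u * deriv K u)) :=
    hK.integrable_mul_comp (φ := fun k => 2 * k) i1 (by fun_prop)
  have j0 : Integrable (fun u => (2 * K u - 1) ^ 2 * deriv K u) :=
    hK.integrable_mul_comp (φ := fun k => (2 * k - 1) ^ 2) hK.integrable_deriv (by fun_prop)
  have hmean' : ∫ u, u * deriv K u = 0 := by simpa [mu] using hmean
  have h1 : muSq K 1 = ∫ u, 2 * K u * (u * deriv K u) := by simpa using hK.muSq_eq 1
  have hd : ∀ u, deriv K (-u) = deriv K u := by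
    intro u
    have e1 : deriv (fun u => K (-u)) u = -deriv K (-u) := deriv_comp_neg K u
    have e2 : (fun u => K (-u)) = fun u => 1 - K u := funext hsym
    rw [e2, deriv_const_sub] at e1
    linarith
  have hodd : ∫ u, (2 * K u - 1) * (u ^ 2 * deriv K u) = 0 := by
    have e := integral_neg_eq_self (fun u => (2 * K u - 1) * (u ^ 2 * deriv K u)) volume
    have e2 : ∀ u, (2 * K (-u) - 1) * ((-u) ^ 2 * deriv K (-u))
        = -((2 * K u - 1) * (u ^ 2 * deriv K u)) := by
      intro u
      rw [hsym, hd]; ring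
    simp only [e2] at e
    rw [integral_neg] at e
    linarith
  have h2 : muSq K 2 = ∫ u, u ^ 2 * deriv K u := by
    rw [hK.muSq_eq 2, ← sub_eq_zero, ← hodd, ← integral_sub _ i2]
    · refine integral_congr_ae (Eventually.of_forall fun u => ?_)
      ring
    · exact hK.integrable_mul_comp (φ := fun k => 2 * k) i2 (by fun_prop)
  set c := muSq K 1
  -- nonnegativity of the second moment of `Z - 3 c (2 K(Z) - 1)`
  have hpos : 0 ≤ ∫ u, (u - 3 * c * (2 * K u - 1)) ^ 2 * deriv K u :=
    integral_nonneg fun u => mul_nonneg (sq_nonneg _) (hK.deriv_nonneg u)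
  have e3 : ∀ u, (u - 3 * c * (2 * K u - 1)) ^ 2 * deriv K u
      = u ^ 2 * deriv K u - 6 * c * (2 * K u * (u * deriv K u)) + 6 * c * (u * deriv K u)
        + 9 * c ^ 2 * ((2 * K u - 1) ^ 2 * deriv K u) := fun u => by ring
  have k1 : Integrable (fun u => u ^ 2 * deriv K u - 6 * c * (2 * K u * (u * deriv K u))) :=
    i2.sub (j1.const_mul _)
  have k2 : Integrable (fun u => u ^ 2 * deriv K u - 6 * c * (2 * K u * (u * deriv K u))
      + 6 * c * (u * deriv K u)) := k1.add (i1.const_mul _)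
  simp only [e3] at hpos
  rw [integral_add k2 (j0.const_mul _), integral_add k1 (i1.const_mul _),
    integral_sub i2 (j1.const_mul _),
    integral_const_mul, integral_const_mul, integral_const_mul, ← h1, hmean', ← h2,
    hK.integral_sq_mul_deriv] at hpos
  linarith

theorem constV_pos (hK : IsCDFKernel K) (hmean : mu K 1 = 0) {γ D : ℝ} (hγ : -2 < γ) (hD : 0 < D) :
    0 < constV γ D K := by
  have h1 := hK.muSq_one_pos hmean
  have h2 : 0 < Real.Gamma (γ / 2 + 1) := Real.Gamma_pos_of_pos (by linarith)
  unfold constV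
  positivity

theorem constB_pos (hK : IsCDFKernel K) (hmean : mu K 1 = 0)
    (hsym : ∀ u : ℝ, K (-u) = 1 - K u) {γ D : ℝ} (hγ : -1 / 2 < γ) (hD : 0 < D) :
    0 < constB γ D K := by
  have h1 := hK.muSq_one_pos hmean
  have h2 := hK.three_mul_muSq_one_sq_le hmean hsym
  have h3 : 0 < Real.Gamma (γ + 2) := Real.Gamma_pos_of_pos (by linarith)
  unfold constB
  refine mul_pos (mul_pos hD h3) ?_
  have e1 : (2 / 3 : ℝ) ^ (γ + 2) = (2 / 3 : ℝ) ^ (γ + 1) * (2 / 3) := by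
    rw [← Real.rpow_add_one (by norm_num)]; congr 1; ring
  -- with `μ_{K²,2} ≥ 3 μ_{K²,1} ^ 2`, the bracket is at least `μ_{K²,1} ^ 2 (5 / 8 - 2 p / 3)` for
  -- `p = (2 / 3) ^ (γ + 1)`
  have hp : (2 / 3 : ℝ) ^ (γ + 1) < 15 / 16 := by
    refine (Real.rpow_lt_rpow_of_exponent_gt (by norm_num) (by norm_num)
      (show (1 / 2 : ℝ) < γ + 1 by linarith)).trans ?_
    rw [← Real.sqrt_eq_rpow, Real.sqrt_lt' (by norm_num)]
    norm_num
  rw [e1]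
  set p := (2 / 3 : ℝ) ^ (γ + 1)
  have hp1 : 0 < 1 - p * (2 / 3) := by linarith
  have hs : 0 < muSq K 2 := by nlinarith
  nlinarith

end IsCDFKernel

/-! ### Positive definiteness of the Hessian -/

theorem posDef_const_add_diagonal {m : ℕ} {I L : ℝ} (hI : 0 ≤ I) (hL : 0 < L) :
    (Matrix.of fun k l : Fin m => I + if k = l then L else 0).PosDef := by
  have h1 : (Matrix.diagonal fun _ : Fin m => L).PosDef := Matrix.PosDef.diagonal fun _ => hL
  have h2 := Matrix.posSemidef_vecMulVec_self_star (fun _ : Fin m => √I)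
  have h3 := h1.add_posSemidef h2
  convert! h3 using 1
  ext k l
  simp [Matrix.vecMulVec_apply, Matrix.diagonal_apply, Real.mul_self_sqrt hI, add_comm]

theorem not_posDef_const_add_diagonal {m : ℕ} (hm : 1 < m) {I L : ℝ} (hL : L ≤ 0) :
    ¬(Matrix.of fun k l : Fin m => I + if k = l then L else 0).PosDef := by
  intro h
  set i : Fin m := ⟨0, by omega⟩
  set j : Fin m := ⟨1, hm⟩
  have hij : i ≠ j := by simp [i, j]
  -- the form of the matrix is `2 L` at the difference of two basis vectors
  have hx : (Pi.single i 1 - Pi.single j 1 : Fin m → ℝ) ≠ 0 := by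
    intro h0
    have := congrFun h0 i
    simp [hij] at this
  have := h.dotProduct_mulVec_pos hx
  simp [Matrix.mulVec_sub, hij, hij.symm] at this
  linarith

namespace RegularTail

variable {F K : ℝ → ℝ} {q a γ D M : ℝ}

theorem integrableOn_b1_sq (h : RegularTail F q a γ D M) (hK : mu K 1 = 0) {n : ℕ} (hn : n ≠ 0) :
    IntegrableOn (fun y => b1 F K n y ^ 2) (qTail F q) := by
  have hc := continuous_gaussMoment n (n - 2)
  rw [h.qTail_eq]
  refine (h.integrableOn_mul_comp h.integrableOn_deriv_sq (ψ := fun u =>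
    (muSq K 1 * ((n : ℝ) * (n - 1) / (2 * n) * gaussMoment n (n - 2) u)) ^ 2)
    (by fun_prop)).congr (Eventually.of_forall fun y => ?_)
  simp only [b1, E1_eq hK hn]
  ring

theorem integrableOn_b0_mul_b2 (h : RegularTail F q a γ D M) (hK : mu K 1 = 0) {n : ℕ}
    (hn : n ≠ 0) : IntegrableOn (fun y => b0 F n y * b2 F K n y) (qTail F q) := by
  have hφ : Continuous (biasCurvature (muSq K 2) (mu K 2) n) :=
    continuous_iff_continuousAt.2 fun u => (hasDerivAt_biasCurvature _ _ hn u).continuousAt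
  simp only [b0_mul_b2_eq hK hn, h.qTail_eq]
  exact (h.integrableOn_mul_comp h.integrable_deriv_deriv hφ).add
    (h.integrableOn_mul_comp h.integrableOn_deriv_sq (continuous_biasSlope _ n))

theorem integrableOn_V2 (h : RegularTail F q a γ D M) (hK : mu K 1 = 0) {n : ℕ}
    (hn : n ≠ 0) : IntegrableOn (V2 F K n) (qTail F q) := by
  have hφ : Continuous (varCurvature (muSq K 2) (mu K 2) n) :=
    continuous_iff_continuousAt.2 fun u => (hasDerivAt_varCurvature _ _ hn u).continuousAt
  rw [show V2 F K n = _ from funext fun y => V2_eq hK hn y, h.qTail_eq]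
  exact (h.integrableOn_mul_comp h.integrable_deriv_deriv hφ).add
    (h.integrableOn_mul_comp h.integrableOn_deriv_sq (continuous_varSlope _ n))

theorem tendsto_integral_b0_mul_b2 (h : RegularTail F q a γ D M) (hK : mu K 1 = 0) :
    Tendsto (fun n : ℕ => (n : ℝ) ^ γ * ∫ y in qTail F q, b0 F n y * b2 F K n y) atTop
      (𝓝 (-constB γ D K)) := by
  refine (h.tendsto_bias (muSq K 2) (mu K 2) (muSq K 1)).congr' ?_
  filter_upwards [eventually_gt_atTop 0] with n hn
  simp only [b0_mul_b2_eq hK hn.ne', h.qTail_eq]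

theorem tendsto_integral_V2 (h : RegularTail F q a γ D M) (hK : mu K 1 = 0) :
    Tendsto (fun n : ℕ => (∫ y in qTail F q, V2 F K n y) / (n : ℝ) ^ (1 - γ / 2)) atTop
      (𝓝 (constV γ D K)) := by
  refine (h.tendsto_var (muSq K 2) (mu K 2) (muSq K 1)).congr' ?_
  filter_upwards [eventually_gt_atTop 0] with n hn
  simp only [V2_eq hK hn.ne', h.qTail_eq]

/-- For equal block sizes the Hessian is a nonnegative constant matrix plus a multiple of the
identity. -/
theorem hessian_eq (h : RegularTail F q a γ D M) (hK : mu K 1 = 0) {n : ℕ} (hn : n ≠ 0) (m : ℕ) :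
    hessian F K q (fun _ : Fin m => n) = Matrix.of fun k l : Fin m =>
      (∫ y in qTail F q, b1 F K n y ^ 2) + if k = l then
        2 * m * (∫ y in qTail F q, b0 F n y * b2 F K n y) + ∫ y in qTail F q, V2 F K n y else 0 := by
  have i1 := h.integrableOn_b1_sq hK hn
  have i2 := h.integrableOn_b0_mul_b2 hK hn
  have i3 := h.integrableOn_V2 hK hn
  ext k l
  simp only [hessian, Matrix.of_apply]
  split_ifs with hkl
  · have e : ∀ y, b1 F K n y * b1 F K n y
          + (2 * (∑ _j : Fin m, b0 F n y) * b2 F K n y + V2 F K n y)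
        = b1 F K n y ^ 2 + (2 * m * (b0 F n y * b2 F K n y) + V2 F K n y) := by
      intro y
      rw [Finset.sum_const, Finset.card_univ, Fintype.card_fin, nsmul_eq_mul]
      ring
    simp only [e]
    have k1 : IntegrableOn (fun y => 2 * m * (b0 F n y * b2 F K n y)) (qTail F q) :=
      i2.const_mul _
    have k2 : IntegrableOn (fun y => 2 * m * (b0 F n y * b2 F K n y) + V2 F K n y) (qTail F q) :=
      k1.add i3
    rw [integral_add i1 k2, integral_add k1 i3, integral_const_mul]
  · simp only [add_zero, ← sq]

theorem hessian_posDef (h : RegularTail F q a γ D M) (hK : mu K 1 = 0) {n : ℕ} (hn : n ≠ 0) {m : ℕ}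
    (hL : 0 < 2 * m * (∫ y in qTail F q, b0 F n y * b2 F K n y) + ∫ y in qTail F q, V2 F K n y) :
    (hessian F K q (fun _ : Fin m => n)).PosDef := by
  rw [h.hessian_eq hK hn]
  exact posDef_const_add_diagonal (integral_nonneg fun y => sq_nonneg _) hL

theorem hessian_not_posDef (h : RegularTail F q a γ D M) (hK : mu K 1 = 0) {n : ℕ} (hn : n ≠ 0)
    {m : ℕ} (hm : 1 < m)
    (hL : 2 * m * (∫ y in qTail F q, b0 F n y * b2 F K n y) + ∫ y in qTail F q, V2 F K n y ≤ 0) :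
    ¬(hessian F K q (fun _ : Fin m => n)).PosDef := by
  rw [h.hessian_eq hK hn]
  exact not_posDef_const_add_diagonal hm hL

end RegularTail

/-- The scaling of the diagonal term `2 m B + V` of the Hessian by `n ^ (1 - γ / 2)`. -/
theorem scaled_eq {n : ℕ} (hn : 0 < n) (γ m B V : ℝ) :
    2 * m * B + V = (n : ℝ) ^ (1 - γ / 2)
      * (2 * (m / (n : ℝ) ^ (1 + γ / 2)) * ((n : ℝ) ^ γ * B) + V / (n : ℝ) ^ (1 - γ / 2)) := by
  have hn' : (0 : ℝ) < n := by exact_mod_cast hn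
  have e : (n : ℝ) ^ (1 + γ / 2) = (n : ℝ) ^ (1 - γ / 2) * (n : ℝ) ^ γ := by
    rw [← Real.rpow_add hn']; congr 1; ring
  have h1 : (n : ℝ) ^ (1 - γ / 2) ≠ 0 := (Real.rpow_pos_of_pos hn' _).ne'
  have h2 : (n : ℝ) ^ γ ≠ 0 := (Real.rpow_pos_of_pos hn' _).ne'
  rw [e]
  field_simp

/-- The diagonal term is affine in `m / n ^ (1 + γ / 2)`, so for its positivity on `[0, C)` the two
endpoints matter only. -/
theorem eventually_scaled_pos {B V : ℕ → ℝ} {γ b v C : ℝ}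
    (hB : Tendsto (fun n : ℕ => (n : ℝ) ^ γ * B n) atTop (𝓝 (-b)))
    (hV : Tendsto (fun n : ℕ => V n / (n : ℝ) ^ (1 - γ / 2)) atTop (𝓝 v))
    (hv : 0 < v) (hC : 0 < C) (hCb : 2 * C * b < v) :
    ∀ᶠ n : ℕ in atTop, ∀ m : ℕ, (m : ℝ) < C * (n : ℝ) ^ (1 + γ / 2) →
      0 < 2 * m * B n + V n := by
  have h1 : Tendsto (fun n : ℕ => 2 * C * ((n : ℝ) ^ γ * B n) + V n / (n : ℝ) ^ (1 - γ / 2)) atTop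
      (𝓝 (2 * C * -b + v)) := (hB.const_mul _).add hV
  filter_upwards [eventually_gt_atTop 0, hV.eventually_const_lt hv,
    h1.eventually_const_lt (show 0 < 2 * C * -b + v by linarith)] with n hn h2 h3 m hm
  have hn' : (0 : ℝ) < n := by exact_mod_cast hn
  have hp : 0 < (n : ℝ) ^ (1 + γ / 2) := Real.rpow_pos_of_pos hn' _
  rw [scaled_eq hn γ]
  refine mul_pos (Real.rpow_pos_of_pos hn' _) ?_
  set r := (m : ℝ) / (n : ℝ) ^ (1 + γ / 2) with hr
  have hr0 : 0 ≤ r := by positivity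
  have hrC : r < C := (div_lt_iff₀ hp).2 hm
  set β := (n : ℝ) ^ γ * B n
  set ν := V n / (n : ℝ) ^ (1 - γ / 2)
  have h4 : 0 < (C - r) * ν + r * (2 * C * β + ν) :=
    add_pos_of_pos_of_nonneg (mul_pos (by linarith) h2) (mul_nonneg hr0 h3.le)
  have h5 : (C - r) * ν + r * (2 * C * β + ν) = C * (2 * r * β + ν) := by ring
  rw [h5] at h4
  exact pos_of_mul_pos_right h4 hC.le

theorem eventually_scaled_neg {B V : ℕ → ℝ} {γ b v C : ℝ}
    (hB : Tendsto (fun n : ℕ => (n : ℝ) ^ γ * B n) atTop (𝓝 (-b)))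
    (hV : Tendsto (fun n : ℕ => V n / (n : ℝ) ^ (1 - γ / 2)) atTop (𝓝 v))
    (hb : 0 < b) (hCb : v < 2 * C * b) :
    ∀ᶠ n : ℕ in atTop, ∀ m : ℕ, C * (n : ℝ) ^ (1 + γ / 2) ≤ (m : ℝ) →
      2 * m * B n + V n ≤ 0 := by
  have h1 : Tendsto (fun n : ℕ => 2 * C * ((n : ℝ) ^ γ * B n) + V n / (n : ℝ) ^ (1 - γ / 2)) atTop
      (𝓝 (2 * C * -b + v)) := (hB.const_mul _).add hV
  filter_upwards [eventually_gt_atTop 0, hB.eventually_lt_const (show -b < 0 by linarith),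
    h1.eventually_lt_const (show 2 * C * -b + v < 0 by linarith)] with n hn h2 h3 m hm
  have hn' : (0 : ℝ) < n := by exact_mod_cast hn
  have hp : 0 < (n : ℝ) ^ (1 + γ / 2) := Real.rpow_pos_of_pos hn' _
  rw [scaled_eq hn γ]
  refine mul_nonpos_of_nonneg_of_nonpos (Real.rpow_nonneg hn'.le _) ?_
  have hrC : C ≤ (m : ℝ) / (n : ℝ) ^ (1 + γ / 2) := (le_div_iff₀ hp).2 hm
  nlinarith

end

end DDEVD

theorem mainTheorem4
    (P : Measure ℝ) [IsProbabilityMeasure P] (K : ℝ → ℝ) (γ D q : ℝ)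
    (hC2 : ∀ y : ℝ, 0 < cdf P y → ContDiffAt ℝ 2 (cdf P) y)
    (hγ : -1 / 2 < γ)
    (hindex : DDEVD.HasExtremeValueIndex (cdf P) γ)
    (hD : 0 < D)
    (htail : DDEVD.HasTailDensity (cdf P) γ D)
    (hq0 : 0 < q) (hq1 : q < 1)
    (hint : IntegrableOn (deriv (deriv (cdf P))) (DDEVD.qTail (cdf P) q))
    (hK : DDEVD.IsCDFKernel K) (hmean : DDEVD.mu K 1 = 0) :
    -- the integrals defining the Hessian converge
    (∀ n : ℕ, 1 < n →
      IntegrableOn (fun y => DDEVD.b1 (cdf P) K n y ^ 2) (DDEVD.qTail (cdf P) q) ∧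
      IntegrableOn (fun y => DDEVD.b0 (cdf P) n y * DDEVD.b2 (cdf P) K n y)
        (DDEVD.qTail (cdf P) q) ∧
      IntegrableOn (DDEVD.V2 (cdf P) K n) (DDEVD.qTail (cdf P) q)) ∧
    -- leading order of the bias and variance integrals
    Tendsto (fun n : ℕ => (n : ℝ) ^ γ *
      ∫ y in DDEVD.qTail (cdf P) q, DDEVD.b0 (cdf P) n y * DDEVD.b2 (cdf P) K n y)
      atTop (𝓝 (-DDEVD.constB γ D K)) ∧
    Tendsto (fun n : ℕ => (∫ y in DDEVD.qTail (cdf P) q, DDEVD.V2 (cdf P) K n y)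
      / (n : ℝ) ^ (1 - γ / 2)) atTop (𝓝 (DDEVD.constV γ D K)) ∧
    0 < DDEVD.constV γ D K ∧
    -- stability
    (∃ C : ℝ, 0 < C ∧ ∀ᶠ n : ℕ in atTop, ∀ m : ℕ, 0 < m →
      (m : ℝ) < C * (n : ℝ) ^ (1 + γ / 2) →
        (DDEVD.hessian (cdf P) K q (fun _ : Fin m => n)).PosDef) ∧
    -- sharp threshold constant `constV / (2 * constB)` whenever `constB` is positive
    (0 < DDEVD.constB γ D K →
      (∀ C : ℝ, C < DDEVD.constV γ D K / (2 * DDEVD.constB γ D K) →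
        ∀ᶠ n : ℕ in atTop, ∀ m : ℕ, 0 < m → (m : ℝ) < C * (n : ℝ) ^ (1 + γ / 2) →
          (DDEVD.hessian (cdf P) K q (fun _ : Fin m => n)).PosDef) ∧
      (∀ C : ℝ, DDEVD.constV γ D K / (2 * DDEVD.constB γ D K) < C →
        ∀ᶠ n : ℕ in atTop, ∀ m : ℕ, C * (n : ℝ) ^ (1 + γ / 2) ≤ (m : ℝ) →
          ¬ (DDEVD.hessian (cdf P) K q (fun _ : Fin m => n)).PosDef)) ∧
    -- for symmetric kernels `constB` is positive
    ((∀ u : ℝ, K (-u) = 1 - K u) → 0 < DDEVD.constB γ D K) := by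
  obtain ⟨a, M, h⟩ := DDEVD.exists_regularTail hC2 (by linarith) htail hq0 hq1 hint
  have hB := h.tendsto_integral_b0_mul_b2 hmean
  have hV := h.tendsto_integral_V2 hmean
  have hVpos := hK.constV_pos hmean (γ := γ) (by linarith) hD
  have hstable : ∀ C : ℝ, 2 * C * DDEVD.constB γ D K < DDEVD.constV γ D K →
      ∀ᶠ n : ℕ in atTop, ∀ m : ℕ, 0 < m → (m : ℝ) < C * (n : ℝ) ^ (1 + γ / 2) →
        (DDEVD.hessian (cdf P) K q (fun _ : Fin m => n)).PosDef := by
    intro C hC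
    rcases le_or_gt C 0 with hC0 | hC0
    · -- no block number qualifies
      refine Eventually.of_forall fun n m hm hlt => ?_
      have h1 : (0 : ℝ) < m := by exact_mod_cast hm
      have h2 : 0 ≤ (n : ℝ) ^ (1 + γ / 2) := Real.rpow_nonneg (Nat.cast_nonneg n) _
      nlinarith
    · filter_upwards [eventually_gt_atTop 0, DDEVD.eventually_scaled_pos hB hV hVpos hC0 hC]
        with n hn hpos m _ hm
      exact h.hessian_posDef hmean hn.ne' (hpos m hm)
  refine ⟨fun n hn => ⟨h.integrableOn_b1_sq hmean (by omega),
    h.integrableOn_b0_mul_b2 hmean (by omega), h.integrableOn_V2 hmean (by omega)⟩,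
    hB, hV, hVpos, ?_, fun hBpos => ⟨fun C hC => ?_, fun C hC => ?_⟩,
    fun hsym => hK.constB_pos hmean hsym hγ hD⟩
  · have hden : 0 < 2 * (|DDEVD.constB γ D K| + 1) := by positivity
    refine ⟨DDEVD.constV γ D K / (2 * (|DDEVD.constB γ D K| + 1)), div_pos hVpos hden,
      hstable _ ?_⟩
    rw [show 2 * (DDEVD.constV γ D K / (2 * (|DDEVD.constB γ D K| + 1))) * DDEVD.constB γ D K
      = DDEVD.constV γ D K * (2 * DDEVD.constB γ D K) / (2 * (|DDEVD.constB γ D K| + 1)) by ring,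
      div_lt_iff₀ hden]
    exact mul_lt_mul_of_pos_left (by linarith [le_abs_self (DDEVD.constB γ D K)]) hVpos
  · refine hstable C ?_
    rw [lt_div_iff₀ (by positivity)] at hC
    linarith
  · have hC0 : 0 < C := (div_pos hVpos (by positivity)).trans hC
    rw [div_lt_iff₀ (by positivity)] at hC
    have hgrow : Tendsto (fun n : ℕ => C * (n : ℝ) ^ (1 + γ / 2)) atTop atTop :=
      ((tendsto_rpow_atTop (by linarith)).comp tendsto_natCast_atTop_atTop).const_mul_atTop hC0
    filter_upwards [eventually_gt_atTop 0, hgrow.eventually_gt_atTop 1,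
      DDEVD.eventually_scaled_neg hB hV hBpos (by linarith)] with n hn hlarge hneg m hm
    have hm1 : 1 < m := by exact_mod_cast hlarge.trans_le hm
    exact h.hessian_not_posDef hmean hn.ne' hm1 (hneg m hm)
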